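/- Let $k$ be a field. An algebraic group over $k$ is a group scheme of finite type over $k$. For an algebraic group $G$ over $k$ and a $k$-scheme $X$, a *$G$-torsor* over $X$ is a morphism of $k$-schemes $p\colon T\to X$ together with a (left) action of $G$ on $T$ over $X$ such that $G\times_k T\to T\times_X T$, $(g,x)\mapsto (x,g\cdot x)$, is an isomorphism, and such that there exist a faithfully flat morphism $X'\to X$ of $k$-schemes, locally of finite presentation, and a $G$-equivariant isomorphism $T\times_X X'\cong G\times_k X'$ over $X'$. The torsor is *split* if it is isomorphic, $G$-equivariantly over $X$, to $G\times_k X\to X$ with $G$ acting by left translations. We say that $G$ *has trivial torsors over semi-local rings* if, for every commutative ring $S$ containing $k$ (i.e. every nonzero commutative $k$-algebra) that has only finitely many maximal ideals, every $G$-torsor over $\operatorname{Spec}(S)$ is split. A smooth connected algebraic group $U$ over $k$ is called *$k$-split unipotent* if there is a tower $1=U_0\hookrightarrow U_1\hookrightarrow\dots\hookrightarrow U_r=U$ of algebraic groups over $k$ ($r\ge 0$) such that each $U_i$ is normal in $U_{i+1}$ and the quotient $U_{i+1}/U_i$ is isomorphic to $\mathbb{G}_a$ over $k$. **Lemma.**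 The following algebraic groups over $k$ have trivial torsors over semi-local rings, for every integer $n\ge 1$: (a) the general linear group $\operatorname{GL}_n$; (b) the special linear group $\operatorname{SL}_n$; (c) the symplectic group $\operatorname{Sp}_{2n}$; (d) every $k$-split smooth connected unipotent group. -/

import Mathlib

open CategoryTheory MonoidalCategory CartesianMonoidalCategory AlgebraicGeometry Opposite

universe u

noncomputable section

namespace SpecialGroups

/-! ### Group schemes given by a representable group functor -/

section Representable

variable (k : Type u) [Field k]

/-- The category of `k`-schemes. -/
abbrev Sch : Type (u + 1) := Over (Spec (CommRingCat.of k))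

/-- A group functor `F` on `k`-algebras gives the group functor `X ↦ F(Γ(X, 𝒪_X))` on
`k`-schemes. -/
abbrev schFunctor (F : CommAlgCat.{u} k ⥤ GrpCat.{u}) : (Sch k)ᵒᵖ ⥤ GrpCat.{u} :=
  (algΓ (CommRingCat.of k)).leftOp ⋙ F

/-- If the `k`-algebra `A` represents the group functor `F` on `k`-algebras, then the `k`-scheme
`Spec A` represents `X ↦ F(Γ(X, 𝒪_X))` on all `k`-schemes. -/
def specRepresentableBy (F : CommAlgCat.{u} k ⥤ GrpCat.{u}) (A : CommAlgCat.{u} k)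
    (e : (F ⋙ forget GrpCat).CorepresentableBy A) :
    (schFunctor k F ⋙ forget GrpCat).RepresentableBy
      ((algSpec (CommRingCat.of k)).obj (op A)) where
  homEquiv {X} :=
    (((algΓAlgSpecAdjunction (CommRingCat.of k)).homEquiv X (op A)).symm.trans
      (opEquiv _ _)).trans e.homEquiv
  homEquiv_comp {X X'} f g := by
    have h := (algΓAlgSpecAdjunction (CommRingCat.of k)).homEquiv_naturality_left_symm f g
    simp only [Equiv.trans_apply, h]
    exact e.homEquiv_comp _ _

/-- The affine group scheme over `k` with coordinate ring `A` representing the group functor `F`: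
the `k`-scheme `Spec A`, with the group structure induced by that of `F` (Yoneda). -/
def affineGroup (F : CommAlgCat.{u} k ⥤ GrpCat.{u}) (A : CommAlgCat.{u} k)
    (e : (F ⋙ forget GrpCat).CorepresentableBy A) : Grp (Sch k) :=
  letI : GrpObj ((algSpec (CommRingCat.of k)).obj (op A)) :=
    GrpObj.ofRepresentableBy _ (schFunctor k F) (specRepresentableBy k F A e)
  ⟨(algSpec (CommRingCat.of k)).obj (op A)⟩

end Representable

/-! ### The groups `GL_n`, `SL_n`, `Sp_{2n}` and `𝔾_a` -/

section Groups

variable (k : Type u) [Field k] (n : ℕ)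

/-- The group functor `R ↦ GL_n(R)`. -/
def glFunctor : CommAlgCat.{u} k ⥤ GrpCat.{u} where
  obj R := GrpCat.of (GL (Fin n) R)
  map f := GrpCat.ofHom (Matrix.GeneralLinearGroup.map f.hom.toRingHom)

/-- The coordinate ring `k[x_{ij}][1/det]` of `GL_n`. -/
abbrev glRing : Type u :=
  Localization.Away (Matrix.mvPolynomialX (Fin n) (Fin n) k).det

/-- The generic invertible matrix `(x_{ij})`. -/
def glGeneric : GL (Fin n) (glRing k n) :=
  Matrix.GeneralLinearGroup.mk''
    ((Algebra.algHom k (MvPolynomial (Fin n × Fin n) k) (glRing k n)).mapMatrix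
      (Matrix.mvPolynomialX (Fin n) (Fin n) k)) (by
    rw [← AlgHom.map_det]
    exact IsLocalization.Away.algebraMap_isUnit _)

theorem isUnit_aeval_det {R : Type u} [CommRing R] [Algebra k R] (M : GL (Fin n) R) :
    IsUnit (MvPolynomial.aeval (fun ij : Fin n × Fin n => M.1 ij.1 ij.2)
      (Matrix.mvPolynomialX (Fin n) (Fin n) k).det) := by
  rw [AlgHom.map_det, Matrix.mvPolynomialX_mapMatrix_aeval]
  exact (Matrix.isUnit_iff_isUnit_det _).1 M.isUnit

/-- The homomorphism `k[x_{ij}][1/det] → R` given by an invertible matrix. -/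
def glLift {R : Type u} [CommRing R] [Algebra k R] (M : GL (Fin n) R) : glRing k n →ₐ[k] R :=
  IsLocalization.Away.liftAlgHom (f := MvPolynomial.aeval fun ij : Fin n × Fin n => M.1 ij.1 ij.2)
    (Matrix.mvPolynomialX (Fin n) (Fin n) k).det (isUnit_aeval_det k n M)

theorem glLift_generic {R : Type u} [CommRing R] [Algebra k R] (M : GL (Fin n) R) (i j : Fin n) :
    glLift k n M ((glGeneric k n).1 i j) = M.1 i j := by
  refine (IsLocalization.Away.lift_eq (S := glRing k n)
    (Matrix.mvPolynomialX (Fin n) (Fin n) k).det (isUnit_aeval_det k n M)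
    (MvPolynomial.X (i, j))).trans ?_
  exact MvPolynomial.aeval_X _ _

/-- `GL_n(R)` is the set of `k`-algebra homomorphisms `k[x_{ij}][1/det] → R`. -/
def glCorepresentableBy :
    (glFunctor k n ⋙ forget GrpCat).CorepresentableBy (CommAlgCat.of k (glRing k n)) where
  homEquiv {R} :=
    { toFun f := Matrix.GeneralLinearGroup.map f.hom.toRingHom (glGeneric k n)
      invFun M := CommAlgCat.ofHom (glLift k n M)
      left_inv f := by
        ext1
        apply IsLocalization.algHom_ext
          (Submonoid.powers (Matrix.mvPolynomialX (Fin n) (Fin n) k).det)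
        ext ij
        exact glLift_generic k n _ ij.1 ij.2
      right_inv M := by
        apply Units.ext
        ext i j
        exact glLift_generic k n M i j }
  homEquiv_comp f g := rfl

/-- The general linear group `GL_n` over `k`. -/
def GLn : Grp (Sch k) := affineGroup k (glFunctor k n) _ (glCorepresentableBy k n)

/-- The group functor `R ↦ SL_n(R)`. -/
def slFunctor : CommAlgCat.{u} k ⥤ GrpCat.{u} where
  obj R := GrpCat.of (Matrix.SpecialLinearGroup (Fin n) R)
  map f := GrpCat.ofHom (Matrix.SpecialLinearGroup.map f.hom.toRingHom)

/-- The ideal generated by `det - 1`. -/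
def slIdeal : Ideal (MvPolynomial (Fin n × Fin n) k) :=
  Ideal.span {(Matrix.mvPolynomialX (Fin n) (Fin n) k).det - 1}

/-- The coordinate ring `k[x_{ij}]/(det - 1)` of `SL_n`. -/
abbrev slRing : Type u := MvPolynomial (Fin n × Fin n) k ⧸ slIdeal k n

/-- The generic matrix `(x_{ij})` of determinant `1`. -/
def slGeneric : Matrix.SpecialLinearGroup (Fin n) (slRing k n) :=
  ⟨(Ideal.Quotient.mkₐ k (slIdeal k n)).mapMatrix (Matrix.mvPolynomialX (Fin n) (Fin n) k), by
    rw [← AlgHom.map_det, ← sub_eq_zero, ← map_one (Ideal.Quotient.mkₐ k (slIdeal k n)), ← map_sub]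
    exact Ideal.Quotient.eq_zero_iff_mem.2 (Ideal.subset_span rfl)⟩

/-- The homomorphism `k[x_{ij}]/(det - 1) → R` given by a matrix of determinant `1`. -/
def slLift {R : Type u} [CommRing R] [Algebra k R] (M : Matrix.SpecialLinearGroup (Fin n) R) :
    slRing k n →ₐ[k] R :=
  Ideal.Quotient.liftₐ _ (MvPolynomial.aeval fun ij : Fin n × Fin n => M.1 ij.1 ij.2) (by
    change slIdeal k n ≤ RingHom.ker _
    rw [slIdeal, Ideal.span_singleton_le_iff_mem, RingHom.mem_ker, map_sub, map_one, AlgHom.map_det,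
      Matrix.mvPolynomialX_mapMatrix_aeval, M.2, sub_self])

theorem slLift_generic {R : Type u} [CommRing R] [Algebra k R]
    (M : Matrix.SpecialLinearGroup (Fin n) R) (i j : Fin n) :
    slLift k n M ((slGeneric k n).1 i j) = M.1 i j :=
  MvPolynomial.aeval_X (fun ij : Fin n × Fin n => M.1 ij.1 ij.2) (i, j)

/-- `SL_n(R)` is the set of `k`-algebra homomorphisms `k[x_{ij}]/(det - 1) → R`. -/
def slCorepresentableBy :
    (slFunctor k n ⋙ forget GrpCat).CorepresentableBy (CommAlgCat.of k (slRing k n)) where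
  homEquiv {R} :=
    { toFun f := Matrix.SpecialLinearGroup.map f.hom.toRingHom (slGeneric k n)
      invFun M := CommAlgCat.ofHom (slLift k n M)
      left_inv f := by
        ext1
        apply Ideal.Quotient.algHom_ext
        ext ij
        exact slLift_generic k n _ ij.1 ij.2
      right_inv M := by
        apply Subtype.ext
        ext i j
        exact slLift_generic k n M i j }
  homEquiv_comp f g := rfl

/-- The special linear group `SL_n` over `k`. -/
def SLn : Grp (Sch k) := affineGroup k (slFunctor k n) _ (slCorepresentableBy k n)

/-- The map induced by a ring homomorphism on symplectic groups. -/
def symplecticMap {R S : Type u} [CommRing R] [CommRing S] (f : R →+* S) :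
    Matrix.symplecticGroup (Fin n) R →* Matrix.symplecticGroup (Fin n) S where
  toFun A := ⟨A.1.map f, SymplecticGroup.map_mem A.2 f⟩
  map_one' := by ext1; simp
  map_mul' A B := by ext1; simp

/-- The group functor `R ↦ Sp_{2n}(R)` of invertible `2n × 2n` matrices preserving the standard
symplectic form. -/
def spFunctor : CommAlgCat.{u} k ⥤ GrpCat.{u} where
  obj R := GrpCat.of (Matrix.symplecticGroup (Fin n) R)
  map f := GrpCat.ofHom (symplecticMap n f.hom.toRingHom)

/-- The generic `2n × 2n` matrix `(x_{ij})`. -/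
abbrev spGeneric :
    Matrix (Fin n ⊕ Fin n) (Fin n ⊕ Fin n) (MvPolynomial ((Fin n ⊕ Fin n) × (Fin n ⊕ Fin n)) k) :=
  Matrix.mvPolynomialX (Fin n ⊕ Fin n) (Fin n ⊕ Fin n) k

/-- The matrix `X J Xᵀ - J`, where `X` is the generic `2n × 2n` matrix and `J` is the matrix of
the standard symplectic form. -/
abbrev spRelation :
    Matrix (Fin n ⊕ Fin n) (Fin n ⊕ Fin n) (MvPolynomial ((Fin n ⊕ Fin n) × (Fin n ⊕ Fin n)) k) :=
  spGeneric k n * Matrix.J (Fin n) _ * (spGeneric k n).transpose - Matrix.J (Fin n) _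

/-- The ideal generated by the entries of `X J Xᵀ - J`. -/
def spIdeal : Ideal (MvPolynomial ((Fin n ⊕ Fin n) × (Fin n ⊕ Fin n)) k) :=
  Ideal.span (Set.range fun ij : (Fin n ⊕ Fin n) × (Fin n ⊕ Fin n) => spRelation k n ij.1 ij.2)

/-- The coordinate ring `k[x_{ij}]/(X J Xᵀ - J)` of `Sp_{2n}`. -/
abbrev spRing : Type u :=
  MvPolynomial ((Fin n ⊕ Fin n) × (Fin n ⊕ Fin n)) k ⧸ spIdeal k n

theorem spRelation_map {R : Type u} [CommRing R] [Algebra k R]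
    (f : MvPolynomial ((Fin n ⊕ Fin n) × (Fin n ⊕ Fin n)) k →ₐ[k] R) :
    (spRelation k n).map f = (spGeneric k n).map f * Matrix.J (Fin n) R *
      ((spGeneric k n).map f).transpose - Matrix.J (Fin n) R := by
  rw [spRelation, Matrix.map_sub _ (map_sub f), Matrix.map_mul, Matrix.map_mul, Matrix.map_J,
    Matrix.transpose_map]

/-- The generic symplectic matrix. -/
def spGenericMem : Matrix.symplecticGroup (Fin n) (spRing k n) :=
  ⟨(spGeneric k n).map (Ideal.Quotient.mkₐ k (spIdeal k n)), by
    rw [SymplecticGroup.mem_iff, ← sub_eq_zero, ← spRelation_map]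
    ext i j
    exact Ideal.Quotient.eq_zero_iff_mem.2 (Ideal.subset_span ⟨(i, j), rfl⟩)⟩

/-- The homomorphism `k[x_{ij}]/(X J Xᵀ - J) → R` given by a symplectic matrix. -/
def spLift {R : Type u} [CommRing R] [Algebra k R] (M : Matrix.symplecticGroup (Fin n) R) :
    spRing k n →ₐ[k] R :=
  Ideal.Quotient.liftₐ _
    (MvPolynomial.aeval fun ij : (Fin n ⊕ Fin n) × (Fin n ⊕ Fin n) => M.1 ij.1 ij.2) (by
      change spIdeal k n ≤ RingHom.ker _
      rw [spIdeal, Ideal.span_le]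
      rintro _ ⟨⟨i, j⟩, rfl⟩
      have h := congrFun (congrFun (spRelation_map k n
        (MvPolynomial.aeval fun ij : (Fin n ⊕ Fin n) × (Fin n ⊕ Fin n) => M.1 ij.1 ij.2)) i) j
      have hM : (spGeneric k n).map (MvPolynomial.aeval fun ij => M.1 ij.1 ij.2) = M.1 := by
        ext i j
        exact MvPolynomial.aeval_X _ _
      rw [hM, SymplecticGroup.mem_iff.1 M.2, sub_self] at h
      exact h)

theorem spLift_generic {R : Type u} [CommRing R] [Algebra k R]
    (M : Matrix.symplecticGroup (Fin n) R) (i j : Fin n ⊕ Fin n) :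
    spLift k n M ((spGenericMem k n).1 i j) = M.1 i j :=
  MvPolynomial.aeval_X (fun ij : (Fin n ⊕ Fin n) × (Fin n ⊕ Fin n) => M.1 ij.1 ij.2) (i, j)

/-- `Sp_{2n}(R)` is the set of `k`-algebra homomorphisms `k[x_{ij}]/(X J Xᵀ - J) → R`. -/
def spCorepresentableBy :
    (spFunctor k n ⋙ forget GrpCat).CorepresentableBy (CommAlgCat.of k (spRing k n)) where
  homEquiv {R} :=
    { toFun f := symplecticMap n f.hom.toRingHom (spGenericMem k n)
      invFun M := CommAlgCat.ofHom (spLift k n M)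
      left_inv f := by
        ext1
        apply Ideal.Quotient.algHom_ext
        ext ij
        exact spLift_generic k n _ ij.1 ij.2
      right_inv M := by
        apply Subtype.ext
        ext i j
        exact spLift_generic k n M i j }
  homEquiv_comp f g := rfl

/-- The symplectic group `Sp_{2n}` over `k`. -/
def Sp2n : Grp (Sch k) := affineGroup k (spFunctor k n) _ (spCorepresentableBy k n)

/-- The group functor `R ↦ (R, +)`. -/
def gaFunctor : CommAlgCat.{u} k ⥤ GrpCat.{u} where
  obj R := GrpCat.of (Multiplicative R)
  map f := GrpCat.ofHom (AddMonoidHom.toMultiplicative f.hom.toRingHom.toAddMonoidHom)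

/-- `(R, +)` is the set of `k`-algebra homomorphisms `k[t] → R`. -/
def gaCorepresentableBy :
    (gaFunctor k ⋙ forget GrpCat).CorepresentableBy (CommAlgCat.of k (Polynomial k)) where
  homEquiv {R} :=
    { toFun f := Multiplicative.ofAdd (f.hom Polynomial.X)
      invFun a := CommAlgCat.ofHom (Polynomial.aeval (Multiplicative.toAdd a : R))
      left_inv f := by
        ext1
        exact Polynomial.algHom_ext (Polynomial.aeval_X _)
      right_inv a := Polynomial.aeval_X (Multiplicative.toAdd a : R) }
  homEquiv_comp f g := rfl

/-- The additive group `𝔾_a` over `k`. -/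
def Ga : Grp (Sch k) := affineGroup k (gaFunctor k) _ (gaCorepresentableBy k)

end Groups

/-! ### Torsors -/

section Torsors

variable {k : Type u} [Field k]

open MonObj

/-- The action of `G` on `G × Y` by left translation on the first factor. -/
@[reducible]
def translation (G Y : Sch k) [MonObj G] : ModObj G (G ⊗ Y) where
  smul := (α_ G G Y).inv ≫ μ[G] ▷ Y
  one_smul := by
    simp [← comp_whiskerRight]
  mul_smul := by
    simp only [selfLeftAction_actionHomLeft, selfLeftAction_actionAssocIso,
      selfLeftAction_actionHomRight]
    rw [associator_inv_naturality_left_assoc, ← comp_whiskerRight, MonObj.mul_assoc]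
    monoidal

/-- `X' → X` is an fppf covering: faithfully flat and locally of finite presentation. -/
structure IsFppfCover {X' X : Sch k} (f : X' ⟶ X) : Prop where
  flat : Flat f.left
  surjective : Surjective f.left
  locallyOfFinitePresentation : LocallyOfFinitePresentation f.left

/-- A `k`-scheme `T` with a left action of `G` and a morphism `p : T ⟶ X` of `k`-schemes is an
*fppf `G`-torsor* over `X`. -/
structure IsFppfTorsor (G : Sch k) [GrpObj G] {T X : Sch k} [ModObj G T] (p : T ⟶ X) : Prop where
  /-- The map `(g, x) ↦ (x, g • x)` is an isomorphism `G ×_k T ≅ T ×_X T`, where `G ×_k T` is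
  the same as `G_X ×_X T`; in particular, `p (g • x) = p x`, i.e. `G` acts over `X`. -/
  isPullback : IsPullback (snd G T) γ[G, T] p p
  /-- There is an fppf covering `f : X' ⟶ X` and a `G`-equivariant isomorphism of `X'`-schemes
  `G ×_k X' ≅ T ×_X X'`. It is given by its first component `h`: the square exhibits `G ×_k X'`,
  with the maps `h` to `T` and the projection to `X'`, as the fibre product of `T` and `X'`
  over `X`. -/
  locallyTrivial : ∃ (X' : Sch k) (f : X' ⟶ X) (h : G ⊗ X' ⟶ T),
    IsFppfCover f ∧ IsPullback h (snd G X') p f ∧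
      (letI := translation G X'; IsModHom G h)

/-- The `G`-torsor `p : T ⟶ X` is *split*: it is isomorphic to `G ×_k X → X`, with `G` acting by
left translations on the first factor. -/
def IsSplitTorsor (G : Sch k) [GrpObj G] {T X : Sch k} [ModObj G T] (p : T ⟶ X) : Prop :=
  ∃ e : G ⊗ X ≅ T, e.hom ≫ p = snd G X ∧ (letI := translation G X; IsModHom G e.hom)

/-- The spectrum of a `k`-algebra, as a `k`-scheme. -/
abbrev specOver (k : Type u) [Field k] (S : Type u) [CommRing S] [Algebra k S] : Sch k :=
  Over.mk (Spec.map (CommRingCat.ofHom (algebraMap k S)))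

/-- `Tors(S, G) = 1` for every semi-local ring `S` containing `k`: every fppf `G`-torsor over
`Spec S` is split. A ring is semi-local if it has finitely many maximal ideals (it need not be
Noetherian); a ring containing `k` is the same as a nonzero `k`-algebra. -/
def HasTrivialTorsorsOverSemilocal (G : Grp (Sch k)) : Prop :=
  ∀ (S : Type u) [CommRing S] [Nontrivial S] [Algebra k S] [Finite (MaximalSpectrum S)]
    (T : Sch k) [ModObj G.X T] (p : T ⟶ specOver k S),
    IsFppfTorsor G.X p → IsSplitTorsor G.X p

end Torsors

/-! ### Split unipotent groups -/

section Unipotent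

variable {k : Type u} [Field k]

open MonObj

/-- The homomorphism `i : N ⟶ U` of group schemes over `k` identifies `N` with the kernel of
the faithfully flat homomorphism `q : U ⟶ Q`; i.e. `1 → N → U → Q → 1` is exact. Equivalently,
`i` identifies `N` with a closed normal subgroup of `U`, and `q` induces an isomorphism
`U/N ≅ Q`. -/
structure IsShortExact {N U Q : Grp (Sch k)} (i : N ⟶ U) (q : U ⟶ Q) : Prop where
  isKernel : IsPullback i.hom.hom (toUnit N.X) q.hom.hom η[Q.X]
  flat : Flat q.hom.hom.left
  surjective : Surjective q.hom.hom.left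

/-- There is a tower `1 = U_0 ↪ U_1 ↪ … ↪ U_r = U` of group schemes over `k` such that each `U_i`
is normal in `U_{i+1}` and `U_{i+1}/U_i` is isomorphic to `𝔾_a` over `k` (here `r ≥ 0`). -/
inductive HasGaTower : Grp (Sch k) → Prop
  | trivial (U : Grp (Sch k)) (h : IsIso (toUnit U.X)) : HasGaTower U
  | step (N U : Grp (Sch k)) (i : N ⟶ U) (q : U ⟶ Ga k) (h : IsShortExact i q)
      (hN : HasGaTower N) : HasGaTower U

/-- `U` is a `k`-split smooth connected unipotent algebraic group over `k`. (By base change, a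
tower over `k` gives one over the algebraic closure, so that `U` is unipotent.) -/
structure IsSplitUnipotent (U : Grp (Sch k)) : Prop where
  locallyOfFiniteType : LocallyOfFiniteType U.X.hom
  quasiCompact : QuasiCompact U.X.hom
  smooth : Smooth U.X.hom
  connected : ConnectedSpace U.X.left
  tower : HasGaTower U

end Unipotent

end SpecialGroups

end

/-!
A section of a torsor over a faithfully flat `S`-algebra `S'` fails to descend to `S` by a Čech
cocycle on `S'`, and the torsor is split as soon as this cocycle becomes a coboundary on some larger
faithfully flat algebra.

A cocycle with values in `GL_n` is a descent datum on `S'^n`. Its module of invariants is finite,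
flat and of constant rank `n`, hence free when `S` is semi-local, and a basis of it writes the
cocycle as a coboundary. For a cocycle with values in `SL_n` or `Sp_{2n}`, a trivialising matrix `h`
in `GL` has a determinant, respectively a pulled back symplectic form `hᵀ J h`, that descends to
`S`, and can be corrected by a matrix over `S` because symplectic forms over `S` are isometric.
Through the matrices `!![1, a; 0, 1]`, a cocycle with values in `𝔾_a` is a descent datum for an
extension of `S'` by `S'`; it descends to an extension of `S` by `S`, and a preimage of `1` splits
the cocycle. A tower with quotients `𝔾_a` is then handled one step at a time by the exact sequence
of non-abelian cohomology.
-/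

noncomputable section

namespace SpecialGroups

open scoped TensorProduct

/-! ### Čech cocycles of group functors -/

section Cocycles

universe v w

variable {C : Type w} [Category.{v} C]

/-- A Čech `1`-cocycle on `X` with values in the group functor `F`. A pair `f g : X ⟶ A` stands for
a pair of points of the covering `X` lying over the same point of the base; no products or
coproducts in `C` are needed to express the cocycle condition in this form. -/
@[ext]
structure Cocycle (F : C ⥤ GrpCat.{u}) (X : C) where
  val {A : C} (f g : X ⟶ A) : F.obj A
  naturality {A B : C} (φ : A ⟶ B) (f g : X ⟶ A) : F.map φ (val f g) = val (f ≫ φ) (g ≫ φ)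
  val_mul_val {A : C} (f g h : X ⟶ A) : val g h * val f g = val f h

namespace Cocycle

variable {F F' : C ⥤ GrpCat.{u}} {X Y Z : C}

theorem val_self (c : Cocycle F X) {A : C} (f : X ⟶ A) : c.val f f = 1 :=
  mul_eq_left.1 (c.val_mul_val f f f)

/-- The image of a cocycle under a homomorphism of group functors. -/
@[simps]
def map (c : Cocycle F X) (α : F ⟶ F') : Cocycle F' X where
  val f g := α.app _ (c.val f g)
  naturality φ f g := by
    rw [← c.naturality φ f g]
    exact (NatTrans.naturality_apply α _ _).symm
  val_mul_val f g h := by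
    rw [← c.val_mul_val f g h, map_mul]

/-- The restriction of a cocycle to a refinement `X ⟶ Y` of the covering `X`. -/
@[simps]
def refine (c : Cocycle F X) (φ : X ⟶ Y) : Cocycle F Y where
  val f g := c.val (φ ≫ f) (φ ≫ g)
  naturality ψ f g := by simp only [c.naturality, Category.assoc]
  val_mul_val f g h := c.val_mul_val _ _ _

/-- The cocycle cohomologous to `c` obtained from the `0`-cochain `u`. -/
@[simps]
def twist (c : Cocycle F X) (u : F.obj X) : Cocycle F X where
  val f g := (F.map g u)⁻¹ * c.val f g * F.map f u
  naturality φ f g := by simp [c.naturality]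
  val_mul_val f g h := by
    rw [← c.val_mul_val f g h]
    group

/-- The `0`-cochain `b` exhibits `c` as the coboundary `(f, g) ↦ g(b) f(b)⁻¹`. -/
def Trivializes (c : Cocycle F X) (b : F.obj X) : Prop :=
  ∀ ⦃A : C⦄ (f g : X ⟶ A), c.val f g * F.map f b = F.map g b

/-- A cocycle is a coboundary if it is of the form `(f, g) ↦ g(b) f(b)⁻¹`. -/
def IsCoboundary (c : Cocycle F X) : Prop :=
  ∃ b, c.Trivializes b

theorem trivializes_map_iff {c : Cocycle F X} {α : F ⟶ F'}
    (hα : ∀ A, Function.Injective (α.app A)) {b : F.obj X} :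
    (c.map α).Trivializes (α.app X b) ↔ c.Trivializes b := by
  refine forall₃_congr fun A f g => ?_
  rw [← (hα A).eq_iff, map_mul, NatTrans.naturality_apply, NatTrans.naturality_apply, map_val]

theorem Trivializes.map {c : Cocycle F X} {b : F.obj X} (hb : c.Trivializes b) (α : F ⟶ F') :
    (c.map α).Trivializes (α.app X b) := fun A f g => by
  rw [← NatTrans.naturality_apply, ← NatTrans.naturality_apply, ← hb f g, map_mul, map_val]

theorem Trivializes.refine {c : Cocycle F X} {b : F.obj X} (hb : c.Trivializes b) (φ : X ⟶ Y) :
    (c.refine φ).Trivializes (F.map φ b) := fun A f g => by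
  simpa using hb (φ ≫ f) (φ ≫ g)

theorem Trivializes.mul_right {c : Cocycle F X} {b x : F.obj X} (hb : c.Trivializes b)
    (hx : ∀ ⦃A : C⦄ (f g : X ⟶ A), F.map f x = F.map g x) : c.Trivializes (b * x) :=
  fun A f g => by rw [map_mul, map_mul, ← mul_assoc, hb, hx f g]

theorem trivializes_twist_iff {c : Cocycle F X} {u b : F.obj X} :
    (c.twist u).Trivializes b ↔ c.Trivializes (u * b) := by
  refine forall₃_congr fun A f g => ?_
  rw [twist_val, map_mul, map_mul, mul_assoc, mul_assoc, inv_mul_eq_iff_eq_mul]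

theorem refine_refine (c : Cocycle F X) (φ : X ⟶ Y) (ψ : Y ⟶ Z) :
    (c.refine φ).refine ψ = c.refine (φ ≫ ψ) := by
  ext A f g
  simp

theorem twist_refine (c : Cocycle F X) (u : F.obj X) (φ : X ⟶ Y) :
    (c.twist u).refine φ = (c.refine φ).twist (F.map φ u) := by
  ext A f g
  simp

theorem map_twist_val_eq_one {c : Cocycle F X} {α : F ⟶ F'} {u : F.obj X}
    (hu : (c.map α).Trivializes (α.app X u)) {A : C} (f g : X ⟶ A) :
    α.app A ((c.twist u).val f g) = 1 := by
  have h := hu f g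
  rw [map_val, ← NatTrans.naturality_apply, ← NatTrans.naturality_apply] at h
  rw [twist_val, mul_assoc, map_mul, map_mul, h, ← map_mul, inv_mul_cancel, map_one]

theorem exists_map_eq (c : Cocycle F' X) {α : F ⟶ F'} (hα : ∀ A, Function.Injective (α.app A))
    (hc : ∀ ⦃A : C⦄ (f g : X ⟶ A), ∃ x, α.app A x = c.val f g) :
    ∃ d : Cocycle F X, d.map α = c := by
  choose val h_val using hc
  refine ⟨⟨fun f g => val f g, fun φ f g => hα _ ?_, fun f g h => hα _ ?_⟩, ?_⟩
  · rw [NatTrans.naturality_apply, h_val, h_val, c.naturality]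
  · rw [map_mul, h_val, h_val, h_val, c.val_mul_val]
  · ext A f g
    exact h_val f g

end Cocycle

/-- Every cocycle of the group functor `F` on a covering, i.e. on an object satisfying `P`, becomes
a coboundary on a finer covering: the first cohomology of `F` vanishes. -/
def HasTrivialCocycles (P : ObjectProperty C) (F : C ⥤ GrpCat.{u}) : Prop :=
  ∀ ⦃X : C⦄, P X → ∀ c : Cocycle F X, ∃ (Y : C) (φ : X ⟶ Y), P Y ∧ (c.refine φ).IsCoboundary

variable {P : ObjectProperty C}

theorem HasTrivialCocycles.of_iso {F F' : C ⥤ GrpCat.{u}} (e : F ≅ F')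
    (h : HasTrivialCocycles P F) : HasTrivialCocycles P F' := fun X hX c => by
  obtain ⟨Y, φ, hY, b, hb⟩ := h hX (c.map e.inv)
  refine ⟨Y, φ, hY, e.hom.app Y b, fun A f g => ?_⟩
  simpa using hb.map e.hom f g

/-- Exactness of `H¹(N) → H¹(U) → H¹(Q)` at `H¹(U)`: a cocycle of `U` that dies in `Q` is
cohomologous to one with values in `N`. -/
theorem HasTrivialCocycles.of_exact {N U Q : C ⥤ GrpCat.{u}} {α : N ⟶ U} {π : U ⟶ Q}
    (hα : ∀ A, Function.Injective (α.app A))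
    (hexact : ∀ ⦃A : C⦄ (u : U.obj A), π.app A u = 1 → ∃ n, α.app A n = u)
    (hπ : ∀ ⦃A : C⦄, P A → ∀ x : Q.obj A,
      ∃ (B : C) (φ : A ⟶ B), P B ∧ ∃ u, π.app B u = Q.map φ x)
    (hN : HasTrivialCocycles P N) (hQ : HasTrivialCocycles P Q) : HasTrivialCocycles P U := by
  intro X hX c
  obtain ⟨Y, φ, hY, x, hx⟩ := hQ hX (c.map π)
  obtain ⟨Z, ψ, hZ, u, hu⟩ := hπ hY x
  have hu_trivializes : (((c.refine φ).refine ψ).map π).Trivializes (π.app Z u) :=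
    hu ▸ hx.refine ψ
  obtain ⟨d, hd⟩ := (((c.refine φ).refine ψ).twist u).exists_map_eq hα fun A f g =>
    hexact _ (Cocycle.map_twist_val_eq_one hu_trivializes f g)
  obtain ⟨W, χ, hW, n, hn⟩ := hN hZ d
  refine ⟨W, (φ ≫ ψ) ≫ χ, hW, U.map χ u * α.app W n, ?_⟩
  rw [← Cocycle.refine_refine, ← Cocycle.refine_refine, ← Cocycle.trivializes_twist_iff,
    ← Cocycle.twist_refine, ← hd]
  exact hn.map α

end Cocycles

/-! ### Faithfully flat descent of free modules -/

section Descent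

variable {S : Type u} [CommRing S]

/-- The object `R ⊗[S] R` of `CommAlgCat S`, i.e. the coproduct of two copies of `R`. -/
abbrev tensorSquare (R : CommAlgCat.{u} S) : CommAlgCat.{u} S := .of S (R ⊗[S] R)

/-- The first coprojection `a ↦ a ⊗ 1`. -/
abbrev coprojLeft (S' : CommAlgCat.{u} S) : S' ⟶ tensorSquare S' :=
  CommAlgCat.ofHom Algebra.TensorProduct.includeLeft

/-- The second coprojection `a ↦ 1 ⊗ a`. -/
abbrev coprojRight (S' : CommAlgCat.{u} S) : S' ⟶ tensorSquare S' :=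
  CommAlgCat.ofHom Algebra.TensorProduct.includeRight

theorem exists_coproj_comp {S' A : CommAlgCat.{u} S} (f g : S' ⟶ A) :
    ∃ φ : tensorSquare S' ⟶ A, coprojLeft S' ≫ φ = f ∧ coprojRight S' ≫ φ = g :=
  ⟨CommAlgCat.ofHom (Algebra.TensorProduct.lift f.hom g.hom fun _ _ => Commute.all _ _),
    by ext; simp, by ext; simp⟩

theorem exists_algebraMap_eq {S' : CommAlgCat.{u} S} [Module.FaithfullyFlat S S'] {a : S'}
    (h : ∀ ⦃A : CommAlgCat.{u} S⦄ (f g : S' ⟶ A), f a = g a) : ∃ s : S, algebraMap S S' s = a := by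
  refine (Algebra.IsEffective.of_faithfullyFlat S S' a).1 ?_
  rw [Algebra.TensorProduct.includeLeftSubRight_apply, sub_eq_zero]
  exact h (coprojLeft S') (coprojRight S')

section TensorEval

variable {ι : Type} {S' A B : CommAlgCat.{u} S}

theorem comp_mulVec [Fintype ι] (φ : A ⟶ B) (M : Matrix ι ι A) (v : ι → A) :
    φ ∘ M.mulVec v = (M.map φ).mulVec (φ ∘ v) :=
  funext fun i => RingHom.map_mulVec φ.hom.toRingHom M v i

variable [Fintype ι] [DecidableEq ι]

/-- The linear map `S' ⊗ B^ι → A^ι` sending `a ⊗ x` to `f(a) g(x)`. -/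
def tensorEval (f : S' ⟶ A) (g : B ⟶ A) : S' ⊗[S] (ι → B) →ₗ[S] (ι → A) :=
  (Algebra.TensorProduct.lift f.hom g.hom fun _ _ => Commute.all _ _).toLinearMap.compLeft ι ∘ₗ
    (TensorProduct.piRight S S S' fun _ : ι => B).toLinearMap

@[simp]
theorem tensorEval_tmul (f : S' ⟶ A) (g : B ⟶ A) (a : S') (x : ι → B) :
    tensorEval f g (a ⊗ₜ x) = f a • (g ∘ x) := by
  ext
  simp [tensorEval]

theorem tensorEval_comp {D : CommAlgCat.{u} S} (φ : A ⟶ D) (f : S' ⟶ A) (g : B ⟶ A)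
    (y : S' ⊗[S] (ι → B)) : tensorEval (f ≫ φ) (g ≫ φ) y = φ ∘ tensorEval f g y := by
  induction y with
  | zero => ext; simp
  | tmul a x => ext; simp
  | add y z hy hz => ext; simp [hy, hz]

theorem tensorEval_include_bijective (S' B : CommAlgCat.{u} S) :
    Function.Bijective (tensorEval (ι := ι)
      (CommAlgCat.ofHom (Algebra.TensorProduct.includeLeft : S' →ₐ[S] S' ⊗[S] B))
      (CommAlgCat.ofHom Algebra.TensorProduct.includeRight)) := by
  have h : Algebra.TensorProduct.lift (Algebra.TensorProduct.includeLeft : S' →ₐ[S] S' ⊗[S] B)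
      Algebra.TensorProduct.includeRight (fun _ _ => Commute.all _ _) = AlgHom.id S _ := by
    ext <;> simp
  convert (TensorProduct.piRight S S S' fun _ : ι => B).bijective using 1
  ext : 1
  simp only [tensorEval, ConcreteCategory.hom_ofHom, h, AlgHom.toLinearMap_id, LinearMap.coe_comp,
    LinearEquiv.coe_coe, Function.comp_apply, TensorProduct.piRight_apply]
  rfl

end TensorEval

variable (S) in
/-- The group functor `A ↦ GL_ι(A)` on `S`-algebras. -/
def glPoints (ι : Type) [Fintype ι] [DecidableEq ι] : CommAlgCat.{u} S ⥤ GrpCat.{u} where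
  obj A := GrpCat.of (GL ι A)
  map f := GrpCat.ofHom (Matrix.GeneralLinearGroup.map f.hom.toRingHom)

variable {ι : Type} [Fintype ι] [DecidableEq ι] {S' A B : CommAlgCat.{u} S}

/-- The value of a cocycle with values in `GL_ι`, as a matrix. -/
def Cocycle.matrix (c : Cocycle (glPoints S ι) S') (f g : S' ⟶ A) : Matrix ι ι A :=
  (c.val f g : GL ι A).1

theorem Cocycle.map_matrix (c : Cocycle (glPoints S ι) S') (φ : A ⟶ B) (f g : S' ⟶ A) :
    (c.matrix f g).map φ = c.matrix (f ≫ φ) (g ≫ φ) :=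
  congrArg (fun M : GL ι B => M.1) (c.naturality φ f g)

theorem Cocycle.matrix_mul_matrix (c : Cocycle (glPoints S ι) S') (f g h : S' ⟶ A) :
    c.matrix g h * c.matrix f g = c.matrix f h :=
  congrArg (fun M : GL ι A => M.1) (c.val_mul_val f g h)

theorem Cocycle.matrix_self (c : Cocycle (glPoints S ι) S') (f : S' ⟶ A) : c.matrix f f = 1 :=
  congrArg (fun M : GL ι A => M.1) (c.val_self f)

/-- The `S`-linear map `x ↦ 1 ⊗ x - C (x ⊗ 1)`, where `C` is the universal value of the cocycle;
its kernel consists of the elements fixed by the descent datum. -/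
def descentDefect (c : Cocycle (glPoints S ι) S') : (ι → S') →ₗ[S] (ι → tensorSquare S') :=
  (coprojRight S').hom.toLinearMap.compLeft ι -
    (Matrix.mulVecLin (c.matrix (coprojLeft S') (coprojRight S'))).restrictScalars S ∘ₗ
      (coprojLeft S').hom.toLinearMap.compLeft ι

theorem descentDefect_apply (c : Cocycle (glPoints S ι) S') (x : ι → S') :
    descentDefect c x = coprojRight S' ∘ x -
      (c.matrix (coprojLeft S') (coprojRight S')).mulVec (coprojLeft S' ∘ x) := rfl

theorem comp_descentDefect (c : Cocycle (glPoints S ι) S') (φ : tensorSquare S' ⟶ A) (x : ι → S') :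
    φ ∘ descentDefect c x = (coprojRight S' ≫ φ) ∘ x -
      (c.matrix (coprojLeft S' ≫ φ) (coprojRight S' ≫ φ)).mulVec ((coprojLeft S' ≫ φ) ∘ x) := by
  have h : φ ∘ descentDefect c x = φ ∘ (coprojRight S' ∘ x) -
      φ ∘ (c.matrix (coprojLeft S') (coprojRight S')).mulVec (coprojLeft S' ∘ x) := by
    ext
    simp [descentDefect_apply]
  rw [h, comp_mulVec, c.map_matrix]
  rfl

theorem tensorEval_lTensor_descentDefect (c : Cocycle (glPoints S ι) S') (f : S' ⟶ A)
    (φ : tensorSquare S' ⟶ A) (y : S' ⊗[S] (ι → S')) :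
    tensorEval f φ ((descentDefect c).lTensor S' y) = tensorEval f (coprojRight S' ≫ φ) y -
      (c.matrix (coprojLeft S' ≫ φ) (coprojRight S' ≫ φ)).mulVec
        (tensorEval f (coprojLeft S' ≫ φ) y) := by
  induction y with
  | zero => simp
  | add y z hy hz =>
    simp only [map_add, hy, hz, Matrix.mulVec_add]
    abel
  | tmul a x =>
    rw [LinearMap.lTensor_tmul, tensorEval_tmul, tensorEval_tmul, tensorEval_tmul,
      comp_descentDefect, smul_sub, Matrix.mulVec_smul]

/-- The `S`-module of elements of `S'^ι` fixed by the descent datum given by a cocycle. -/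
def invariants (c : Cocycle (glPoints S ι) S') : Submodule S (ι → S') :=
  LinearMap.ker (descentDefect c)

theorem exact_invariants (c : Cocycle (glPoints S ι) S') :
    Function.Exact (invariants c).subtype (descentDefect c) :=
  LinearMap.exact_subtype_ker_map _

theorem comp_eq_mulVec_of_mem_invariants {c : Cocycle (glPoints S ι) S'} {x : ι → S'}
    (hx : x ∈ invariants c) (f g : S' ⟶ A) : g ∘ x = (c.matrix f g).mulVec (f ∘ x) := by
  obtain ⟨φ, rfl, rfl⟩ := exists_coproj_comp f g
  rw [← sub_eq_zero, ← comp_descentDefect, LinearMap.mem_ker.1 hx]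
  ext
  simp

/-- The `S'`-linear extension `S' ⊗ M → S'^ι` of the inclusion of the invariants `M`. -/
def invariantsBaseChange (c : Cocycle (glPoints S ι) S') :
    S' ⊗[S] invariants c →ₗ[S'] (ι → S') :=
  (invariants c).subtype.liftBaseChange S'

theorem tensorEval_invariants (c : Cocycle (glPoints S ι) S') (e f g : S' ⟶ A)
    (m : S' ⊗[S] invariants c) :
    tensorEval e g ((invariants c).subtype.lTensor S' m) =
      (c.matrix f g).mulVec (tensorEval e f ((invariants c).subtype.lTensor S' m)) := by
  obtain ⟨φ, rfl, rfl⟩ := exists_coproj_comp f g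
  rw [← sub_eq_zero, ← tensorEval_lTensor_descentDefect, ← LinearMap.lTensor_comp_apply,
    (exact_invariants c).linearMap_comp_eq_zero, LinearMap.lTensor_zero, LinearMap.zero_apply,
    map_zero]

theorem tensorEval_self (c : Cocycle (glPoints S ι) S') (f : S' ⟶ A) (m : S' ⊗[S] invariants c) :
    tensorEval f f ((invariants c).subtype.lTensor S' m) = f ∘ invariantsBaseChange c m := by
  induction m with
  | zero => ext; simp
  | add y z hy hz => ext; simp [hy, hz]
  | tmul a x => ext; simp [invariantsBaseChange]

theorem invariantsBaseChange_injective [Module.Flat S S'] (c : Cocycle (glPoints S ι) S') :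
    Function.Injective (invariantsBaseChange c) := by
  rw [injective_iff_map_eq_zero]
  intro m hm
  apply Module.Flat.lTensor_preserves_injective_linearMap (M := S') (invariants c).subtype
    Subtype.val_injective
  apply (tensorEval_include_bijective S' S').1
  have h_zero : coprojLeft S' ∘ (0 : ι → S') = 0 := by ext; simp
  rw [tensorEval_invariants c _ (coprojLeft S'), tensorEval_self, hm, h_zero, Matrix.mulVec_zero,
    map_zero, map_zero]

theorem invariantsBaseChange_surjective [Module.Flat S S'] (c : Cocycle (glPoints S ι) S') :
    Function.Surjective (invariantsBaseChange c) := by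
  intro w
  obtain ⟨y, hy⟩ := (tensorEval_include_bijective S' S').2
    ((c.matrix (coprojLeft S') (coprojRight S')).mulVec (coprojLeft S' ∘ w))
  have tensorEval_y ⦃A : CommAlgCat.{u} S⦄ (f g : S' ⟶ A) :
      tensorEval f g y = (c.matrix f g).mulVec (f ∘ w) := by
    obtain ⟨φ, rfl, rfl⟩ := exists_coproj_comp f g
    rw [tensorEval_comp, hy, comp_mulVec, c.map_matrix]
    rfl
  have defect_y : (descentDefect c).lTensor S' y = 0 := by
    apply (tensorEval_include_bijective S' (tensorSquare S')).1
    rw [tensorEval_lTensor_descentDefect, tensorEval_y, tensorEval_y, Matrix.mulVec_mulVec,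
      c.matrix_mul_matrix, sub_self, map_zero]
  obtain ⟨m, rfl⟩ := (Module.Flat.lTensor_exact S' (exact_invariants c) y).1 defect_y
  have h := tensorEval_y (𝟙 S') (𝟙 S')
  rw [c.matrix_self, tensorEval_self, Matrix.one_mulVec] at h
  exact ⟨m, h⟩

/-- Faithfully flat descent: the invariants are a form of `S'^ι` over `S`. -/
def invariantsEquiv [Module.Flat S S'] (c : Cocycle (glPoints S ι) S') :
    S' ⊗[S] invariants c ≃ₗ[S'] (ι → S') :=
  LinearEquiv.ofBijective (invariantsBaseChange c)
    ⟨invariantsBaseChange_injective c, invariantsBaseChange_surjective c⟩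

theorem invariantsEquiv_one_tmul [Module.Flat S S'] (c : Cocycle (glPoints S ι) S')
    (x : invariants c) : invariantsEquiv c (1 ⊗ₜ x) = x.1 := by
  simp [invariantsEquiv, invariantsBaseChange]

section FaithfullyFlat

variable [Module.FaithfullyFlat S S']

theorem finite_invariants (c : Cocycle (glPoints S ι) S') : Module.Finite S (invariants c) := by
  have : Module.Finite S' (S' ⊗[S] invariants c) := Module.Finite.equiv (invariantsEquiv c).symm
  exact Module.Finite.of_finite_tensorProduct_of_faithfullyFlat S'

theorem flat_invariants (c : Cocycle (glPoints S ι) S') : Module.Flat S (invariants c) := by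
  have : Module.Flat S' (S' ⊗[S] invariants c) := Module.Flat.of_linearEquiv (invariantsEquiv c)
  exact Module.Flat.of_flat_tensorProduct S _ S'

theorem rankAtStalk_invariants (c : Cocycle (glPoints S ι) S') (p : PrimeSpectrum S) :
    Module.rankAtStalk (invariants c) p = Fintype.card ι := by
  have := finite_invariants c
  have := flat_invariants c
  obtain ⟨q, rfl⟩ := PrimeSpectrum.comap_surjective_of_faithfullyFlat (A := S) (B := S') p
  have : Nontrivial S' := q.nontrivial
  rw [← Module.rankAtStalk_baseChange, Module.rankAtStalk_eq_of_equiv (invariantsEquiv c),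
    Module.rankAtStalk_eq_finrank_of_free, Module.finrank_pi]
  rfl

end FaithfullyFlat

theorem isUnit_of_basis_invariants [Module.Flat S S'] {c : Cocycle (glPoints S ι) S'}
    (b : Module.Basis ι S (invariants c)) : IsUnit (Matrix.of fun i j => (b j).1 i) := by
  let b' := (b.baseChange S').map (invariantsEquiv c)
  have h : (Matrix.of fun i j => (b j).1 i) = (Pi.basisFun S' ι).toMatrix b' := by
    ext i j
    simp [Module.Basis.toMatrix_apply, b', invariantsEquiv_one_tmul]
  rw [h]
  let := (Pi.basisFun S' ι).invertibleToMatrix b'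
  exact isUnit_of_invertible _

theorem isCoboundary_of_basis_invariants [Module.Flat S S'] {c : Cocycle (glPoints S ι) S'}
    (b : Module.Basis ι S (invariants c)) : c.IsCoboundary :=
  ⟨(isUnit_of_basis_invariants b).unit, fun _ f g => Units.ext <| Matrix.ext fun i j =>
    (congrFun (comp_eq_mulVec_of_mem_invariants (b j).2 f g) i).symm⟩

end Descent

/-! ### Vanishing of cohomology -/

section Vanishing

/-- Every finite flat `S`-module of constant rank is free: the property of semi-local rings that
trivialises the torsors under the classical groups. -/
def FreeOfConstantRank (S : Type u) [CommRing S] : Prop :=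
  ∀ (M : Type u) [AddCommGroup M] [Module S M] [Module.Finite S M] [Module.Flat S M] (n : ℕ),
    (∀ p : PrimeSpectrum S, Module.rankAtStalk M p = n) → Nonempty (Module.Basis (Fin n) S M)

theorem freeOfConstantRank_of_finite_maximalSpectrum (S : Type u) [CommRing S]
    [Finite (MaximalSpectrum S)] : FreeOfConstantRank S := fun M _ _ _ _ n h => by
  refine Module.nonempty_basis_of_flat_of_finrank_eq S M n fun P => ?_
  let := Ideal.Quotient.field P.1
  have h_residue := Module.rankAtStalk_baseChange (R := S) (M := M) (⊥ : PrimeSpectrum (S ⧸ P.1))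
  rwa [h, Module.rankAtStalk_eq_finrank_of_free] at h_residue

variable (S : Type u) [CommRing S]

/-- The faithfully flat `S`-algebras: the affine coverings of `Spec S`. -/
def faithfullyFlat : ObjectProperty (CommAlgCat.{u} S) := fun A => Module.FaithfullyFlat S A

variable {S} {ι : Type} [Fintype ι] [DecidableEq ι]

theorem FreeOfConstantRank.isCoboundary (hS : FreeOfConstantRank S) {S' : CommAlgCat.{u} S}
    (hS' : faithfullyFlat S S') (c : Cocycle (glPoints S ι) S') : c.IsCoboundary := by
  have : Module.FaithfullyFlat S S' := hS'
  have := finite_invariants c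
  have := flat_invariants c
  obtain ⟨b⟩ := hS (invariants c) (Fintype.card ι) (rankAtStalk_invariants c)
  exact isCoboundary_of_basis_invariants (b.reindex (Fintype.equivFin ι).symm)

theorem hasTrivialCocycles_of_isCoboundary {F : CommAlgCat.{u} S ⥤ GrpCat.{u}}
    (h : ∀ ⦃S'⦄, faithfullyFlat S S' → ∀ c : Cocycle F S', c.IsCoboundary) :
    HasTrivialCocycles (faithfullyFlat S) F := fun S' hS' c => by
  obtain ⟨b, hb⟩ := h hS' c
  exact ⟨S', 𝟙 S', hS', _, hb.refine (𝟙 S')⟩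

theorem FreeOfConstantRank.hasTrivialCocycles_gl (hS : FreeOfConstantRank S) :
    HasTrivialCocycles (faithfullyFlat S) (glPoints S ι) :=
  hasTrivialCocycles_of_isCoboundary fun _ hS' c => hS.isCoboundary hS' c

theorem Cocycle.Trivializes.isCoboundary_of_map {F : CommAlgCat.{u} S ⥤ GrpCat.{u}}
    {S' : CommAlgCat.{u} S} {c : Cocycle F S'} {α : F ⟶ glPoints S ι}
    (hα : ∀ A, Function.Injective (α.app A)) {h : GL ι S'} (hh : (c.map α).Trivializes h)
    (x : GL ι S) {b : F.obj S'}
    (hb : α.app S' b = h * Matrix.GeneralLinearGroup.map (algebraMap S S') x) : c.IsCoboundary := by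
  refine ⟨b, (trivializes_map_iff hα).1 (hb ▸ hh.mul_right fun A f g => ?_)⟩
  have h_map (φ : S' ⟶ A) : Matrix.GeneralLinearGroup.map φ.hom.toRingHom
      (Matrix.GeneralLinearGroup.map (algebraMap S S') x) =
        Matrix.GeneralLinearGroup.map (algebraMap S A) x := by
    ext i j
    simp
  exact (h_map f).trans (h_map g).symm

variable (S ι) in
/-- The group functor `A ↦ SL_ι(A)` on `S`-algebras. -/
def slPoints : CommAlgCat.{u} S ⥤ GrpCat.{u} where
  obj A := GrpCat.of (Matrix.SpecialLinearGroup ι A)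
  map f := GrpCat.ofHom (Matrix.SpecialLinearGroup.map f.hom.toRingHom)

variable (S ι) in
/-- The inclusion of `SL_ι` in `GL_ι`. -/
def slToGL : slPoints S ι ⟶ glPoints S ι where
  app A := GrpCat.ofHom Matrix.SpecialLinearGroup.toGL
  naturality A B f := by
    ext M
    exact Units.ext rfl

theorem exists_unit_algebraMap_eq {S' : CommAlgCat.{u} S} (hS' : faithfullyFlat S S') (u : S'ˣ)
    (h : ∀ ⦃A : CommAlgCat.{u} S⦄ (f g : S' ⟶ A), f u.1 = g u.1) :
    ∃ s : Sˣ, Units.map (algebraMap S S') s = u := by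
  have : Module.FaithfullyFlat S S' := hS'
  obtain ⟨s, hs⟩ := exists_algebraMap_eq h
  have h_unit : IsUnit s := isUnit_of_map_unit (algebraMap S S') s (hs ▸ u.isUnit)
  exact ⟨h_unit.unit, Units.ext hs⟩

theorem FreeOfConstantRank.hasTrivialCocycles_sl (hS : FreeOfConstantRank S) :
    HasTrivialCocycles (faithfullyFlat S) (slPoints S ι) := by
  refine hasTrivialCocycles_of_isCoboundary fun S' hS' c => ?_
  rcases isEmpty_or_nonempty ι with _ | _
  · exact ⟨(1 : Matrix.SpecialLinearGroup ι S'), fun A f g =>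
      (Subsingleton.elim _ _ : _ = (_ : Matrix.SpecialLinearGroup ι A))⟩
  obtain ⟨h : GL ι S', hh⟩ := hS.isCoboundary hS' (c.map (slToGL S ι))
  have det_invariant ⦃A : CommAlgCat.{u} S⦄ (f g : S' ⟶ A) : f h.1.det = g h.1.det := by
    let M : Matrix.SpecialLinearGroup ι A := c.val f g
    have h_det : (M.1 * f.hom.mapMatrix h.1).det = (g.hom.mapMatrix h.1).det :=
      congrArg (fun M : GL ι A => M.1.det) (hh f g)
    rwa [Matrix.det_mul, M.2, one_mul, ← AlgHom.map_det, ← AlgHom.map_det] at h_det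
  obtain ⟨s, hs⟩ := exists_unit_algebraMap_eq hS' (Matrix.GeneralLinearGroup.det h) det_invariant
  obtain ⟨x, hx⟩ := Matrix.GeneralLinearGroup.det_surjective (n := ι) s⁻¹
  have det_eq_one : (h * Matrix.GeneralLinearGroup.map (algebraMap S S') x).1.det = 1 := by
    rw [← Matrix.GeneralLinearGroup.val_det_apply, map_mul, ← hs,
      Matrix.GeneralLinearGroup.map_det, hx]
    simp
  exact hh.isCoboundary_of_map (fun _ => Matrix.SpecialLinearGroup.toGL_injective) x
    (b := (⟨_, det_eq_one⟩ : Matrix.SpecialLinearGroup ι S')) (Units.ext rfl)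

section Additive

variable (S) in
/-- The group functor `A ↦ (A, +)` on `S`-algebras. -/
def gaPoints : CommAlgCat.{u} S ⥤ GrpCat.{u} where
  obj A := GrpCat.of (Multiplicative A)
  map f := GrpCat.ofHom (AddMonoidHom.toMultiplicative f.hom.toRingHom.toAddMonoidHom)

variable (S) in
/-- The embedding of `𝔾_a` in `GL_2` by upper triangular unipotent matrices. -/
def gaToGL : gaPoints S ⟶ glPoints S (Fin 2) where
  app A := GrpCat.ofHom (Matrix.GeneralLinearGroup.upperRightHom (R := A)).toMonoidHom
  naturality A B f := by
    ext a
    refine Units.ext (Matrix.ext fun i j => ?_)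
    change (!![1, f.hom (Multiplicative.toAdd a); 0, 1] : Matrix (Fin 2) (Fin 2) B) i j =
      f.hom ((!![1, Multiplicative.toAdd a; 0, 1] : Matrix (Fin 2) (Fin 2) A) i j)
    fin_cases i <;> fin_cases j <;> simp

variable {S' : CommAlgCat.{u} S}

/-- The value of a cocycle with values in `𝔾_a`, as a ring element. -/
def Cocycle.scalar (c : Cocycle (gaPoints S) S') {A : CommAlgCat.{u} S} (f g : S' ⟶ A) : A :=
  Multiplicative.toAdd (α := A) (c.val f g)

theorem map_apply_of_mem_invariants_ga {c : Cocycle (gaPoints S) S'} {x : Fin 2 → S'}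
    (hx : x ∈ invariants (c.map (gaToGL S))) {A : CommAlgCat.{u} S} (f g : S' ⟶ A) :
    g (x 0) = f (x 0) + c.scalar f g * f (x 1) ∧ g (x 1) = f (x 1) := by
  have h : g ∘ x = (!![1, c.scalar f g; 0, 1] :
      Matrix (Fin 2) (Fin 2) A).mulVec (f ∘ x) := comp_eq_mulVec_of_mem_invariants hx f g
  constructor
  · simpa [Matrix.mulVec, dotProduct] using congrFun h 0
  · simpa [Matrix.mulVec, dotProduct] using congrFun h 1

/-- The second coordinates of the invariants form an ideal of `S` that generates the unit ideal of
`S'`; by faithful flatness it is the unit ideal. -/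
theorem exists_mem_invariants_ga (hS' : faithfullyFlat S S') (c : Cocycle (gaPoints S) S') :
    ∃ x ∈ invariants (c.map (gaToGL S)), x 1 = 1 := by
  have : Module.FaithfullyFlat S S' := hS'
  let M := invariants (c.map (gaToGL S))
  let I : Ideal S := (M.map (LinearMap.proj 1)).comap (Algebra.linearMap S S')
  have mem_map_I (m : S' ⊗[S] M) :
      invariantsBaseChange (c.map (gaToGL S)) m 1 ∈ I.map (algebraMap S S') := by
    induction m with
    | zero => simp
    | add y z hy hz => rw [map_add]; exact Ideal.add_mem _ hy hz
    | tmul a x =>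
      obtain ⟨s, hs⟩ := exists_algebraMap_eq fun A f g =>
        (map_apply_of_mem_invariants_ga x.2 g f).2
      have hsI : s ∈ I := ⟨x.1, x.2, hs.symm⟩
      simpa [invariantsBaseChange, hs] using
        Ideal.mul_mem_left _ a (Ideal.mem_map_of_mem (algebraMap S S') hsI)
  obtain ⟨m, hm⟩ := invariantsBaseChange_surjective (c.map (gaToGL S)) 1
  have one_mem_I : (1 : S) ∈ I := by
    rw [← Ideal.comap_map_eq_self_of_faithfullyFlat (B := S') I, Ideal.mem_comap, map_one]
    simpa [hm] using mem_map_I m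
  simpa [I, M] using one_mem_I

variable (S) in
theorem hasTrivialCocycles_ga : HasTrivialCocycles (faithfullyFlat S) (gaPoints S) := by
  refine hasTrivialCocycles_of_isCoboundary fun S' hS' c => ?_
  obtain ⟨x, hx, hx1⟩ := exists_mem_invariants_ga hS' c
  refine ⟨Multiplicative.ofAdd (x 0), fun A f g => ?_⟩
  change Multiplicative.ofAdd (c.scalar f g + f (x 0)) = Multiplicative.ofAdd (g (x 0))
  rw [(map_apply_of_mem_invariants_ga hx f g).1, hx1, map_one, mul_one, add_comm]

end Additive

/-! ### Symplectic bases -/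

section SymplecticBases

variable {M : Type u} [AddCommGroup M] [Module S M]

/-- The orthogonal complement of the plane spanned by `e` and `f`. -/
def planeOrthogonal (B : LinearMap.BilinForm S M) (e f : M) : Submodule S M :=
  LinearMap.ker (B e) ⊓ LinearMap.ker (B f)

variable {B : LinearMap.BilinForm S M} {e f : M}

theorem apply_left_planeOrthogonal (x : planeOrthogonal B e f) : B e x.1 = 0 := x.2.1

theorem apply_right_planeOrthogonal (x : planeOrthogonal B e f) : B f x.1 = 0 := x.2.2

theorem planeOrthogonal_apply_left (hB : B.IsAlt) (x : planeOrthogonal B e f) : B x.1 e = 0 := by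
  rw [← hB.neg_eq, apply_left_planeOrthogonal, neg_zero]

theorem planeOrthogonal_apply_right (hB : B.IsAlt) (x : planeOrthogonal B e f) : B x.1 f = 0 := by
  rw [← hB.neg_eq, apply_right_planeOrthogonal, neg_zero]

/-- The projection to the orthogonal complement of a hyperbolic plane. -/
def planeProjection (hB : B.IsAlt) (h : B f e = 1) : M →ₗ[S] planeOrthogonal B e f :=
  LinearMap.codRestrict (planeOrthogonal B e f)
    (LinearMap.id - (B f).smulRight e + (B e).smulRight f) fun x => by
      have hef : B e f = -1 := by rw [← hB.neg_eq, h]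
      constructor
      · simp [LinearMap.mem_ker, hB e, hef]
      · simp [LinearMap.mem_ker, hB f, h]

theorem planeProjection_apply (hB : B.IsAlt) (h : B f e = 1) (x : M) :
    (planeProjection hB h x).1 = x - B f x • e + B e x • f := rfl

theorem planeProjection_coe (hB : B.IsAlt) (h : B f e = 1) (x : planeOrthogonal B e f) :
    planeProjection hB h x = x := by
  apply Subtype.ext
  rw [planeProjection_apply, apply_left_planeOrthogonal, apply_right_planeOrthogonal]
  simp

/-- A module with an alternating form is the direct sum of a hyperbolic plane and its orthogonal
complement. -/
def planeDecomposition (hB : B.IsAlt) (h : B f e = 1) :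
    M ≃ₗ[S] (S × S) × planeOrthogonal B e f where
  toLinearMap := LinearMap.prod ((B f).prod (-(B e))) (planeProjection hB h)
  invFun x := x.1.1 • e + x.1.2 • f + x.2.1
  left_inv x := by
    simp only [LinearMap.coe_prod, AddHom.toFun_eq_coe, LinearMap.coe_toAddHom, Function.prod_apply,
      planeProjection_apply, LinearMap.neg_apply, neg_smul]
    abel
  right_inv := by
    rintro ⟨⟨a, b⟩, x⟩
    have hef : B e f = -1 := by rw [← hB.neg_eq, h]
    have hf : B f (a • e + b • f + x.1) = a := by
      simp [hB f, h, apply_right_planeOrthogonal]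
    have he : B e (a • e + b • f + x.1) = -b := by
      simp [hB e, hef, apply_left_planeOrthogonal]
    refine Prod.ext (Prod.ext hf ?_) (Subtype.ext ?_)
    · simp [he]
    · change (planeProjection hB h (a • e + b • f + x.1)).1 = x.1
      rw [planeProjection_apply, hf, he, neg_smul]
      abel

theorem finite_planeOrthogonal [Module.Finite S M] (hB : B.IsAlt) (h : B f e = 1) :
    Module.Finite S (planeOrthogonal B e f) :=
  Module.Finite.of_surjective (planeProjection hB h) fun x => ⟨x.1, planeProjection_coe hB h x⟩

theorem flat_planeOrthogonal [Module.Flat S M] (hB : B.IsAlt) (h : B f e = 1) :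
    Module.Flat S (planeOrthogonal B e f) :=
  Module.Flat.of_retract (planeOrthogonal B e f).subtype (planeProjection hB h)
    (LinearMap.ext (planeProjection_coe hB h))

theorem rankAtStalk_eq_planeOrthogonal [Module.Finite S M] [Module.Flat S M] (hB : B.IsAlt)
    (h : B f e = 1) (p : PrimeSpectrum S) :
    Module.rankAtStalk M p = 2 + Module.rankAtStalk (planeOrthogonal B e f) p := by
  have := p.nontrivial
  have := finite_planeOrthogonal hB h
  have := flat_planeOrthogonal hB h
  rw [Module.rankAtStalk_eq_of_equiv (planeDecomposition hB h), Module.rankAtStalk_prod,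
    Module.rankAtStalk_prod]
  simp

/-- The restriction of a form to the orthogonal complement of a plane. -/
def planeForm (B : LinearMap.BilinForm S M) (e f : M) :
    LinearMap.BilinForm S (planeOrthogonal B e f) :=
  B.restrict _

theorem planeForm_apply (x y : planeOrthogonal B e f) : planeForm B e f x y = B x.1 y.1 := rfl

theorem planeForm_planeProjection (hB : B.IsAlt) (h : B f e = 1) (x : M)
    (y : planeOrthogonal B e f) : planeForm B e f (planeProjection hB h x) y = B x y.1 := by
  simp [planeForm_apply, planeProjection_apply, apply_left_planeOrthogonal,
    apply_right_planeOrthogonal]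

theorem isAlt_planeForm (hB : B.IsAlt) : (planeForm B e f).IsAlt := fun x => hB x.1

theorem planeForm_bijective (hB : B.IsAlt) (h : B f e = 1) (hbij : Function.Bijective B) :
    Function.Bijective (planeForm B e f) := by
  refine ⟨(injective_iff_map_eq_zero _).2 fun x hx => Subtype.ext (hbij.1 ?_), fun ψ => ?_⟩
  · ext y
    rw [← hB.neg_eq, ← planeForm_planeProjection hB h, (isAlt_planeForm hB).neg_eq, hx]
    simp
  · obtain ⟨x, hx⟩ := hbij.2 (ψ ∘ₗ planeProjection hB h)
    refine ⟨planeProjection hB h x, LinearMap.ext fun y => ?_⟩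
    rw [planeForm_planeProjection, hx, LinearMap.comp_apply, planeProjection_coe]

theorem exists_symplectic_family_succ {n : ℕ} (hB : B.IsAlt) (h : B f e = 1)
    {w : Fin n ⊕ Fin n → planeOrthogonal B e f}
    (hw : ∀ i j, planeForm B e f (w i) (w j) = Matrix.J (Fin n) S i j) :
    ∃ v : Fin (n + 1) ⊕ Fin (n + 1) → M, ∀ i j, B (v i) (v j) = Matrix.J (Fin (n + 1)) S i j := by
  have hef : B e f = -1 := by rw [← hB.neg_eq, h]
  simp only [planeForm_apply] at hw
  refine ⟨Sum.elim (Fin.cons e fun i => (w (.inl i)).1) (Fin.cons f fun i => (w (.inr i)).1), ?_⟩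
  rintro (i | i) (j | j) <;> induction i using Fin.cases <;> induction j using Fin.cases <;>
    simp [hB e, hB f, h, hef, hw, planeOrthogonal_apply_left hB, planeOrthogonal_apply_right hB,
      apply_left_planeOrthogonal, apply_right_planeOrthogonal, Matrix.J, Matrix.one_apply,
      Fin.succ_ne_zero, (Fin.succ_ne_zero _).symm]

theorem FreeOfConstantRank.exists_hyperbolic_pair (hS : FreeOfConstantRank S) [Module.Finite S M]
    [Module.Flat S M] {n : ℕ} (hrank : ∀ p : PrimeSpectrum S, Module.rankAtStalk M p = n + 1)
    (hbij : Function.Bijective B) : ∃ e f, B f e = 1 := by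
  obtain ⟨b⟩ := hS M (n + 1) hrank
  obtain ⟨f, hf⟩ := hbij.2 (b.coord 0)
  exact ⟨b 0, f, by simp [hf]⟩

theorem FreeOfConstantRank.exists_symplectic_family (hS : FreeOfConstantRank S) (n : ℕ) :
    ∀ (M : Type u) [AddCommGroup M] [Module S M] [Module.Finite S M] [Module.Flat S M]
      (B : LinearMap.BilinForm S M), (∀ p : PrimeSpectrum S, Module.rankAtStalk M p = 2 * n) →
      B.IsAlt → Function.Bijective B →
      ∃ v : Fin n ⊕ Fin n → M, ∀ i j, B (v i) (v j) = Matrix.J (Fin n) S i j := by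
  induction n with
  | zero => exact fun M _ _ _ _ B _ _ _ => ⟨fun _ => 0, fun i => isEmptyElim i⟩
  | succ n ih =>
    intro M _ _ _ _ B hrank hB hbij
    obtain ⟨e, f, h⟩ := hS.exists_hyperbolic_pair (n := 2 * n + 1) hrank hbij
    have := finite_planeOrthogonal hB h
    have := flat_planeOrthogonal hB h
    have rank_planeOrthogonal (p : PrimeSpectrum S) :
        Module.rankAtStalk (planeOrthogonal B e f) p = 2 * n := by
      have := rankAtStalk_eq_planeOrthogonal hB h p
      have := hrank p
      lia
    obtain ⟨w, hw⟩ := ih (planeOrthogonal B e f) (planeForm B e f) rank_planeOrthogonal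
      (isAlt_planeForm hB) (planeForm_bijective hB h hbij)
    exact exists_symplectic_family_succ hB h hw

theorem bijective_toBilin' {ι : Type} [Fintype ι] [DecidableEq ι] {Ω : Matrix ι ι S}
    (hΩ : IsUnit Ω) : Function.Bijective (Matrix.toBilin' Ω) := by
  have h (x : ι → S) : Matrix.toBilin' Ω x = dotProductEquiv S ι (Matrix.vecMul x Ω) :=
    LinearMap.ext fun y => (Matrix.toBilin'_apply' Ω x y).trans (Matrix.dotProduct_mulVec x Ω y)
  rw [show ⇑(Matrix.toBilin' Ω) = dotProductEquiv S ι ∘ fun x => Matrix.vecMul x Ω from funext h]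
  exact (dotProductEquiv S ι).bijective.comp
    ⟨Matrix.vecMul_injective_of_isUnit hΩ, Matrix.vecMul_surjective_iff_isUnit.2 hΩ⟩

open Matrix in
theorem FreeOfConstantRank.exists_congruent_J (hS : FreeOfConstantRank S) {n : ℕ}
    {Ω : Matrix (Fin n ⊕ Fin n) (Fin n ⊕ Fin n) S} (hΩ : IsUnit Ω)
    (halt : ∀ v, v ⬝ᵥ Ω *ᵥ v = 0) :
    ∃ P : GL (Fin n ⊕ Fin n) S, P.1ᵀ * Ω * P.1 = Matrix.J (Fin n) S := by
  obtain ⟨v, hv⟩ := hS.exists_symplectic_family n (Fin n ⊕ Fin n → S) (Matrix.toBilin' Ω)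
    (fun p => by
      have := p.nontrivial
      simp [two_mul])
    (fun x => (Matrix.toBilin'_apply' Ω x x).trans (halt x)) (bijective_toBilin' hΩ)
  have h_congr : (of v)ᵀᵀ * Ω * (of v)ᵀ = Matrix.J (Fin n) S := by
    ext i j
    rw [← hv i j, Matrix.toBilin'_apply', Matrix.dotProduct_mulVec]
    rfl
  have h_unit : IsUnit (of v)ᵀ := by
    rw [Matrix.isUnit_iff_isUnit_det]
    apply isUnit_of_mul_isUnit_right (x := ((of v)ᵀᵀ * Ω).det)
    rw [← Matrix.det_mul, h_congr]
    exact Matrix.isUnit_det_J _ _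
  exact ⟨h_unit.unit, h_congr⟩

end SymplecticBases

section SymplecticGroup

variable (S) in
/-- The group functor `A ↦ Sp_{2n}(A)` on `S`-algebras. -/
def spPoints (n : ℕ) : CommAlgCat.{u} S ⥤ GrpCat.{u} where
  obj A := GrpCat.of (Matrix.symplecticGroup (Fin n) A)
  map f := GrpCat.ofHom (symplecticMap n f.hom.toRingHom)

variable (S) in
/-- The inclusion of `Sp_{2n}` in `GL_{2n}`. -/
def spToGL (n : ℕ) : spPoints S n ⟶ glPoints S (Fin n ⊕ Fin n) where
  app A := GrpCat.ofHom (Matrix.symplecticGroup (Fin n) A).subtype.toHomUnits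
  naturality A B f := by
    ext M
    exact Units.ext rfl

theorem spToGL_injective (n : ℕ) (A : CommAlgCat.{u} S) :
    Function.Injective ((spToGL S n).app A) := fun _ _ h =>
  Subtype.ext (congrArg (fun M : GL (Fin n ⊕ Fin n) A => M.1) h)

open Matrix

theorem exists_matrix_map_algebraMap_eq {m : Type} {S' : CommAlgCat.{u} S}
    (hS' : faithfullyFlat S S') {ω : Matrix m m S'}
    (h : ∀ ⦃A : CommAlgCat.{u} S⦄ (f g : S' ⟶ A), ω.map f = ω.map g) :
    ∃ Ω : Matrix m m S, Ω.map (algebraMap S S') = ω := by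
  have : Module.FaithfullyFlat S S' := hS'
  choose Ω hΩ using fun i j => exists_algebraMap_eq fun A f g => congrFun₂ (h f g) i j
  exact ⟨of Ω, Matrix.ext hΩ⟩

section PullbackJ

variable {l : Type} [Fintype l] [DecidableEq l] {A B : Type u} [CommRing A] [CommRing B]

/-- The matrix of the pullback of the standard symplectic form along a linear map. -/
def pullbackJ (M : Matrix (l ⊕ l) (l ⊕ l) A) : Matrix (l ⊕ l) (l ⊕ l) A :=
  Mᵀ * J l A * M

theorem pullbackJ_map (φ : A →+* B) (M : Matrix (l ⊕ l) (l ⊕ l) A) :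
    (pullbackJ M).map φ = pullbackJ (M.map φ) := by
  simp [pullbackJ, Matrix.map_mul, transpose_map]

theorem pullbackJ_mul (M N : Matrix (l ⊕ l) (l ⊕ l) A) :
    pullbackJ (M * N) = Nᵀ * pullbackJ M * N := by
  simp only [pullbackJ, transpose_mul, Matrix.mul_assoc]

theorem isUnit_pullbackJ (M : GL (l ⊕ l) A) : IsUnit (pullbackJ M.1) := by
  have h := (isUnit_iff_isUnit_det _).1 M.isUnit
  rw [isUnit_iff_isUnit_det, pullbackJ, det_mul, det_mul, det_transpose]
  exact (h.mul (isUnit_det_J l A)).mul h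

theorem dotProduct_J_mulVec_self (v : l ⊕ l → A) : v ⬝ᵥ J l A *ᵥ v = 0 := by
  simp [J, fromBlocks_mulVec, neg_mulVec, dotProduct, Fintype.sum_sum_type, mul_comm]

theorem dotProduct_pullbackJ_mulVec_self (M : Matrix (l ⊕ l) (l ⊕ l) A) (v : l ⊕ l → A) :
    v ⬝ᵥ pullbackJ M *ᵥ v = 0 := by
  rw [pullbackJ, ← mulVec_mulVec, ← mulVec_mulVec, dotProduct_mulVec, vecMul_transpose,
    dotProduct_J_mulVec_self]

end PullbackJ

theorem pullbackJ_map_eq_of_trivializes {n : ℕ} {S' : CommAlgCat.{u} S}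
    {c : Cocycle (spPoints S n) S'} {h : GL (Fin n ⊕ Fin n) S'}
    (hh : (c.map (spToGL S n)).Trivializes h) {A : CommAlgCat.{u} S} (f g : S' ⟶ A) :
    (pullbackJ h.1).map f = (pullbackJ h.1).map g := by
  let M : symplecticGroup (Fin n) A := c.val f g
  have h_mul : M.1 * h.1.map f = h.1.map g :=
    congrArg (fun M : GL (Fin n ⊕ Fin n) A => M.1) (hh f g)
  have hM : pullbackJ M.1 = J (Fin n) A := SymplecticGroup.mem_iff'.1 M.2
  have h_map (φ : S' ⟶ A) : (pullbackJ h.1).map φ = pullbackJ (h.1.map φ) :=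
    pullbackJ_map φ.hom.toRingHom h.1
  rw [h_map, h_map, ← h_mul, pullbackJ_mul, hM, pullbackJ]

theorem FreeOfConstantRank.hasTrivialCocycles_sp (hS : FreeOfConstantRank S) (n : ℕ) :
    HasTrivialCocycles (faithfullyFlat S) (spPoints S n) := by
  refine hasTrivialCocycles_of_isCoboundary fun S' hS' c => ?_
  have : Module.FaithfullyFlat S S' := hS'
  obtain ⟨h : GL (Fin n ⊕ Fin n) S', hh⟩ := hS.isCoboundary hS' (c.map (spToGL S n))
  obtain ⟨Ω, hΩ⟩ := exists_matrix_map_algebraMap_eq hS' fun A f g =>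
    pullbackJ_map_eq_of_trivializes hh f g
  have isUnit_Ω : IsUnit Ω := by
    rw [isUnit_iff_isUnit_det]
    apply isUnit_of_map_unit (algebraMap S S')
    rw [RingHom.map_det, RingHom.mapMatrix_apply, hΩ, ← isUnit_iff_isUnit_det]
    exact isUnit_pullbackJ h
  have isAlt_Ω v : v ⬝ᵥ Ω *ᵥ v = 0 := by
    apply FaithfulSMul.algebraMap_injective S S'
    have map_mulVec : algebraMap S S' ∘ (Ω *ᵥ v) = pullbackJ h.1 *ᵥ (algebraMap S S' ∘ v) :=
      hΩ ▸ funext fun i => RingHom.map_mulVec (algebraMap S S') Ω v i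
    rw [RingHom.map_dotProduct, map_zero, map_mulVec, dotProduct_pullbackJ_mulVec_self]
  obtain ⟨P, hP⟩ := hS.exists_congruent_J isUnit_Ω isAlt_Ω
  have mem_sp : h.1 * P.1.map (algebraMap S S') ∈ symplecticGroup (Fin n) S' := by
    refine SymplecticGroup.mem_iff'.2 ?_
    change pullbackJ _ = _
    rw [pullbackJ_mul, ← hΩ, ← transpose_map, ← Matrix.map_mul, ← Matrix.map_mul, hP, map_J]
  exact hh.isCoboundary_of_map (spToGL_injective n) P
    (b := (⟨_, mem_sp⟩ : symplecticGroup (Fin n) S')) (Units.ext rfl)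

end SymplecticGroup

end Vanishing

/-! ### Flat coverings by affine schemes -/

section AffineCover

variable {X Y : Scheme.{u}}

theorem exists_isAffine_flat_surjective_comp [CompactSpace X] (f : Y ⟶ X) [Flat f]
    [QuasiCompactCover (PreZeroHypercover.singleton.{0} f)] :
    ∃ (Z : Scheme.{u}) (g : Z ⟶ Y), IsAffine Z ∧ Flat (g ≫ f) ∧ Surjective (g ≫ f) := by
  obtain ⟨n, V, hV, h_cover⟩ : ∃ (n : ℕ) (V : Fin n → Y.Opens), (∀ i, IsAffineOpen (V i)) ∧
      ⋃ i, f '' (V i) = Set.univ := by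
    obtain ⟨n, _, V, hV, h_cover⟩ := QuasiCompactCover.exists_isAffineOpen_of_isCompact
      (.singleton f) (U := ⊤) isCompact_univ
    exact ⟨n, V, hV, h_cover⟩
  have (i : Fin n) : IsAffine (V i : Scheme.{u}) := hV i
  let g : (∐ fun i => (V i : Scheme.{u})) ⟶ Y := Limits.Sigma.desc fun i => (V i).ι
  have : Flat g := inferInstanceAs (Flat (Limits.Sigma.desc fun i => (V i).ι))
  refine ⟨_, g, inferInstance, inferInstance, ⟨fun x => ?_⟩⟩
  obtain ⟨i, y, hy, rfl⟩ := Set.mem_iUnion.1 (h_cover.ge (Set.mem_univ x))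
  obtain ⟨v, rfl⟩ : ∃ v : (V i : Scheme.{u}), (V i).ι v = y := ⟨⟨y, hy⟩, rfl⟩
  refine ⟨Limits.Sigma.ι (fun i => (V i : Scheme.{u})) i v, ?_⟩
  rw [← Scheme.Hom.comp_apply, Limits.Sigma.ι_desc_assoc, Scheme.Hom.comp_apply]

theorem quasiCompactCover_singleton_of_isOpenMap (f : Y ⟶ X) [Surjective f] (hf : IsOpenMap f) :
    QuasiCompactCover (PreZeroHypercover.singleton.{0} f) :=
  QuasiCompactCover.of_isOpenMap (𝒰 := f.cover (P := ⊤) trivial) fun _ => hf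

end AffineCover

/-! ### Points over an algebra -/

section Points

variable {k : Type u} [Field k]

section Functor

variable (k : Type u) [Field k] (S : Type u) [CommRing S] [Algebra k S]

/-- Restriction of scalars from `S`-algebras to `k`-algebras. -/
def restrictScalars : CommAlgCat.{u} S ⥤ CommAlgCat.{u} k where
  obj A := @CommAlgCat.of k _ A _ (Algebra.compHom A (algebraMap k S))
  map {A B} φ :=
    letI := Algebra.compHom A (algebraMap k S)
    letI := Algebra.compHom B (algebraMap k S)
    CommAlgCat.ofHom { φ.hom with commutes' := fun r => φ.hom.commutes (algebraMap k S r) }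

/-- The functor sending an `S`-algebra to its spectrum, as a `k`-scheme. -/
def specFunctor : (CommAlgCat.{u} S)ᵒᵖ ⥤ Sch k :=
  (restrictScalars k S).op ⋙ algSpec (CommRingCat.of k)

variable {k} in
/-- The structure morphism `Spec A ⟶ Spec S` of an `S`-algebra `A`. -/
def specStr (A : CommAlgCat.{u} S) : (specFunctor k S).obj (op A) ⟶ specOver k S :=
  Over.homMk (Spec.map (CommRingCat.ofHom (algebraMap S A))) (Spec.map_comp _ _).symm

end Functor

variable {S : Type u} [CommRing S] [Algebra k S] {A B : CommAlgCat.{u} S}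

theorem specFunctor_map_specStr (φ : A ⟶ B) :
    (specFunctor k S).map φ.op ≫ specStr S A = specStr S B := by
  ext1
  refine (Spec.map_comp (CommRingCat.ofHom (algebraMap S A))
    (CommRingCat.ofHom φ.hom.toRingHom)).symm.trans ?_
  exact congrArg (fun f => Spec.map (CommRingCat.ofHom f)) φ.hom.comp_algebraMap

theorem exists_specFunctor_map_eq
    (g : (specFunctor k S).obj (op B) ⟶ (specFunctor k S).obj (op A))
    (hg : g ≫ specStr S A = specStr S B) : ∃ φ : A ⟶ B, (specFunctor k S).map φ.op = g := by
  let ψ : CommRingCat.of A ⟶ CommRingCat.of B := Spec.preimage g.left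
  have hψ : Spec.map ψ = g.left := Spec.map_preimage _
  have h_comp : CommRingCat.ofHom (algebraMap S A) ≫ ψ = CommRingCat.ofHom (algebraMap S B) := by
    refine Spec.map_injective ?_
    rw [Spec.map_comp, hψ]
    exact congrArg (fun f => f.left) hg
  refine ⟨CommAlgCat.ofHom { ψ.hom with
    commutes' := fun s => ConcreteCategory.congr_hom h_comp s }, ?_⟩
  ext1
  exact hψ

theorem exists_faithfullyFlat_comp_eq {P : Sch k} (g : P ⟶ specOver k S) [Flat g.left]
    [QuasiCompactCover (PreZeroHypercover.singleton.{0} g.left)] :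
    ∃ (A : CommAlgCat.{u} S) (v : (specFunctor k S).obj (op A) ⟶ P),
      faithfullyFlat S A ∧ v ≫ g = specStr S A := by
  have : CompactSpace (specOver k S).left :=
    inferInstanceAs (CompactSpace (Spec (CommRingCat.of S)))
  obtain ⟨Z, h, _, _, _⟩ := exists_isAffine_flat_surjective_comp g.left
  let ψ : CommRingCat.of S ⟶ Γ(Z, ⊤) := Spec.preimage (Z.isoSpec.inv ≫ h ≫ g.left)
  have hψ : Spec.map ψ = Z.isoSpec.inv ≫ h ≫ g.left := Spec.map_preimage _
  let := ψ.hom.toAlgebra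
  let A : CommAlgCat.{u} S := .of S Γ(Z, ⊤)
  refine ⟨A, Over.homMk (Z.isoSpec.inv ≫ h) ?_, ?_, ?_⟩
  · have h_over : (Z.isoSpec.inv ≫ h) ≫ P.hom =
        (Z.isoSpec.inv ≫ h ≫ g.left) ≫ (specOver k S).hom := by
      rw [Category.assoc, Category.assoc, Category.assoc, Over.w g]
    exact h_over.trans
      ((congrArg (· ≫ (specOver k S).hom) hψ.symm).trans (Over.w (specStr S A)))
  · refine (flat_and_surjective_SpecMap_iff ψ).1 ?_
    rw [hψ]
    exact ⟨inferInstance, inferInstance⟩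
  · ext1
    exact (Category.assoc _ _ _).trans hψ.symm

theorem flat_and_surjective_specStr (hA : faithfullyFlat S A) :
    Flat (specStr (k := k) S A).left ∧ Surjective (specStr (k := k) S A).left :=
  (flat_and_surjective_SpecMap_iff (CommRingCat.ofHom (algebraMap S A))).2
    (RingHom.faithfullyFlat_algebraMap_iff.2 hA)

instance : QuasiCompact (specStr (k := k) S A).left :=
  inferInstanceAs (QuasiCompact (Spec.map (CommRingCat.ofHom (algebraMap S A))))

theorem effectiveEpi_specStr_left (hA : faithfullyFlat S A) :
    EffectiveEpi (specStr (k := k) S A).left := by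
  obtain ⟨_, _⟩ := flat_and_surjective_specStr (k := k) hA
  infer_instance

theorem epi_specStr (hA : faithfullyFlat S A) : Epi (specStr (k := k) S A) := by
  have := effectiveEpi_specStr_left (k := k) hA
  exact Over.epi_of_epi_left _

theorem exists_specStr_comp_eq (hA : faithfullyFlat S A) {T : Sch k}
    (t : (specFunctor k S).obj (op A) ⟶ T)
    (ht : ∀ ⦃B : CommAlgCat.{u} S⦄ (f g : A ⟶ B),
      (specFunctor k S).map f.op ≫ t = (specFunctor k S).map g.op ≫ t) :
    ∃ σ : specOver k S ⟶ T, specStr S A ≫ σ = t := by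
  have := effectiveEpi_specStr_left (k := k) hA
  have h_pullback : IsPullback ((specFunctor k S).map (coprojLeft A).op).left
      ((specFunctor k S).map (coprojRight A).op).left
      (specStr (k := k) S A).left (specStr (k := k) S A).left :=
    isPullback_SpecMap_of_isPushout _ _ _ _ (CommRingCat.isPushout_tensorProduct S A A)
  have h_desc {Z : Scheme.{u}} (g₁ g₂ : Z ⟶ ((specFunctor k S).obj (op A)).left)
      (h : g₁ ≫ (specStr S A).left = g₂ ≫ (specStr S A).left) : g₁ ≫ t.left = g₂ ≫ t.left := by
    obtain ⟨l, rfl, rfl⟩ := h_pullback.exists_lift g₁ g₂ h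
    simpa using congrArg (fun f => l ≫ f.left) (ht (coprojLeft A) (coprojRight A))
  have h_fac := EffectiveEpi.fac (specStr (k := k) S A).left t.left h_desc
  refine ⟨Over.homMk (EffectiveEpi.desc (specStr S A).left t.left h_desc) ?_, ?_⟩
  · rw [← cancel_epi (specStr (k := k) S A).left, ← Category.assoc, h_fac, Over.w t,
      Over.w (specStr S A)]
  · ext1
    exact h_fac

end Points

section FunctorOfPoints

universe v

/-- If the right adjoint `R : Cᵒᵖ ⥤ D` of `L : D ⥤ Cᵒᵖ` is fully faithful, then `A ↦ L(R(A))` is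
isomorphic to the identity. -/
def rightOpCompLeftOpIso {C D : Type*} [Category* C] [Category* D] {L : D ⥤ Cᵒᵖ} {R : Cᵒᵖ ⥤ D}
    (adj : L ⊣ R) [R.Full] [R.Faithful] : R.rightOp ⋙ L.leftOp ≅ 𝟭 C :=
  (NatIso.ofComponents (fun A => (asIso (adj.counit.app (op A))).unop)
    fun f => (congrArg Quiver.Hom.unop (adj.counit.naturality f.op)).symm).symm

/-- The functor of points of the group object given by a representable functor. -/
def yonedaGrpIso {C : Type*} [Category.{v} C] [CartesianMonoidalCategory C] (X : C)
    (F : Cᵒᵖ ⥤ GrpCat.{v}) (α : (F ⋙ forget GrpCat).RepresentableBy X) :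
    letI := GrpObj.ofRepresentableBy X F α
    yonedaGrp.obj (Grp.mk X) ≅ F :=
  yonedaGrpObjIsoOfRepresentableBy X F α

variable {k : Type u} [Field k] (S : Type u) [CommRing S] [Algebra k S]

/-- The functor of points of a group scheme on `S`-algebras. -/
def pointsFunctor (G : Grp (Sch k)) : CommAlgCat.{u} S ⥤ GrpCat.{u} :=
  (specFunctor k S).rightOp ⋙ yonedaGrp.obj G

/-- The homomorphism of functors of points induced by a homomorphism of group schemes. -/
def pointsMap {G H : Grp (Sch k)} (f : G ⟶ H) : pointsFunctor S G ⟶ pointsFunctor S H :=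
  Functor.whiskerLeft _ (yonedaGrp.map f)

variable {S} in
/-- The functor `A ↦ Γ(Spec A)` is isomorphic to the forgetful functor. -/
def specFunctorCompΓIso :
    (specFunctor k S).rightOp ⋙ (algΓ (CommRingCat.of k)).leftOp ≅ restrictScalars k S :=
  have : (algSpec (CommRingCat.of k)).Full := algSpec.instFull
  have : (algSpec (CommRingCat.of k)).Faithful := algSpec.instFaithful
  Functor.isoWhiskerLeft (restrictScalars k S)
    (rightOpCompLeftOpIso (algΓAlgSpecAdjunction (CommRingCat.of k)))

variable (F : CommAlgCat.{u} k ⥤ GrpCat.{u}) (R : CommAlgCat.{u} k)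
  (e : (F ⋙ forget GrpCat).CorepresentableBy R)

/-- The functor of points of the affine group scheme representing `F` on all `k`-schemes. -/
def yonedaAffineGroupIso : yonedaGrp.obj (affineGroup k F R e) ≅ schFunctor k F :=
  yonedaGrpIso _ (schFunctor k F) (specRepresentableBy k F R e)

/-- The affine group scheme representing `F` has `F` as its functor of points. -/
def pointsAffineGroupIso :
    pointsFunctor S (affineGroup k F R e) ≅ restrictScalars k S ⋙ F :=
  Functor.isoWhiskerLeft (specFunctor k S).rightOp (yonedaAffineGroupIso F R e) ≪≫
    Functor.isoWhiskerRight specFunctorCompΓIso F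

end FunctorOfPoints

/-! ### Torsors and cocycles -/

section Torsor

open scoped MonObj

section SimplyTransitive

universe v w

variable {C : Type w} [Category.{v} C] [CartesianMonoidalCategory C] {G : C} [GrpObj G] {T X : C}
  [ModObj G T] {p : T ⟶ X}

theorem smul_comp_of_isPullback (hp : IsPullback (snd G T) γ[G,T] p p) {Z : C} (m : Z ⟶ G)
    (t : Z ⟶ T) : (m • t) ≫ p = t ≫ p := by
  rw [Hom.smul_def, Category.assoc, ← hp.w, lift_snd_assoc]

/-- The point of `G` that moves `t` to `t'`, when `G` acts simply transitively on the fibres. -/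
def transporter (hp : IsPullback (snd G T) γ[G,T] p p) {Z : C} {t t' : Z ⟶ T}
    (h : t ≫ p = t' ≫ p) : Z ⟶ G :=
  hp.lift t t' h ≫ fst G T

theorem transporter_smul (hp : IsPullback (snd G T) γ[G,T] p p) {Z : C} {t t' : Z ⟶ T}
    (h : t ≫ p = t' ≫ p) : transporter hp h • t = t' := by
  have h_lift : lift (transporter hp h) t = hp.lift t t' h := by
    ext <;> simp [transporter]
  rw [Hom.smul_def, h_lift, hp.lift_snd]

theorem eq_transporter (hp : IsPullback (snd G T) γ[G,T] p p) {Z : C} {t t' : Z ⟶ T}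
    (h : t ≫ p = t' ≫ p) {m : Z ⟶ G} (hm : m • t = t') : m = transporter hp h := by
  have : lift m t = hp.lift t t' h := hp.hom_ext (by simp) (by rw [hp.lift_snd]; exact hm)
  rw [transporter, ← this, lift_fst]

theorem transporter_mul_transporter (hp : IsPullback (snd G T) γ[G,T] p p) {Z : C}
    {t₁ t₂ t₃ : Z ⟶ T} (h₂₃ : t₂ ≫ p = t₃ ≫ p) (h₁₂ : t₁ ≫ p = t₂ ≫ p) :
    transporter hp h₂₃ * transporter hp h₁₂ = transporter hp (h₁₂.trans h₂₃) :=
  eq_transporter hp _ (by rw [mul_smul, transporter_smul, transporter_smul])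

theorem comp_transporter (hp : IsPullback (snd G T) γ[G,T] p p) {Y Z : C} (f : Y ⟶ Z)
    {t t' : Z ⟶ T} (h : t ≫ p = t' ≫ p) :
    f ≫ transporter hp h = transporter hp (t := f ≫ t) (t' := f ≫ t') (by simp [h]) :=
  eq_transporter hp _ (by rw [← ModObj.comp_smul, transporter_smul])

end SimplyTransitive

variable {k : Type u} [Field k]

section Split

variable {G : Sch k} [GrpObj G] {T X : Sch k} [ModObj G T]

/-- The morphism `G × X ⟶ T`, `(g, x) ↦ g • σ(x)`. -/
def orbitMap (G : Sch k) [GrpObj G] [ModObj G T] (σ : X ⟶ T) : G ⊗ X ⟶ T :=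
  fst G X • (snd G X ≫ σ)

theorem isModHom_orbitMap (σ : X ⟶ T) :
    letI := translation G X; IsModHom G (orbitMap G σ) := by
  let := translation G X
  refine ⟨?_⟩
  have h_fst : γ[G, G ⊗ X] ≫ fst G X = fst G (G ⊗ X) * (snd G (G ⊗ X) ≫ fst G X) := by
    change ((α_ G G X).inv ≫ μ[G] ▷ X) ≫ fst G X = _
    rw [Hom.mul_def, Category.assoc, whiskerRight_fst, ← Category.assoc]
    congr 1
    ext <;> simp
  have h_snd : γ[G, G ⊗ X] ≫ snd G X = snd G (G ⊗ X) ≫ snd G X := by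
    change ((α_ G G X).inv ≫ μ[G] ▷ X) ≫ snd G X = _
    simp
  have h_smul : G ◁ orbitMap G σ ≫ γ[G,T] =
      fst G (G ⊗ X) • (snd G (G ⊗ X) ≫ orbitMap G σ) := by
    rw [Hom.smul_def]
    congr 1
  change γ[G, G ⊗ X] ≫ orbitMap G σ = G ◁ orbitMap G σ ≫ γ[G,T]
  rw [h_smul, orbitMap, ModObj.comp_smul, ModObj.comp_smul, h_fst, reassoc_of% h_snd, mul_smul]

theorem isSplitTorsor_of_section {p : T ⟶ X} (hp : IsPullback (snd G T) γ[G,T] p p) {σ : X ⟶ T}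
    (hσ : σ ≫ p = 𝟙 X) : IsSplitTorsor G p := by
  have h_over : orbitMap G σ ≫ p = snd G X := by
    rw [orbitMap, smul_comp_of_isPullback hp, Category.assoc, hσ, Category.comp_id]
  have h_retract : (p ≫ σ) ≫ p = 𝟙 T ≫ p := by
    rw [Category.assoc, hσ, Category.comp_id, Category.id_comp]
  let m : T ⟶ G := transporter hp h_retract
  have hm : m • (p ≫ σ) = 𝟙 T := transporter_smul hp h_retract
  have h_fst : orbitMap G σ ≫ m = fst G X := by
    rw [comp_transporter]
    refine (eq_transporter hp _ ?_).symm
    rw [reassoc_of% h_over, Category.comp_id, orbitMap]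
  refine ⟨⟨orbitMap G σ, lift m p, ?_, ?_⟩, h_over, isModHom_orbitMap σ⟩
  · ext
    · rw [Category.assoc, lift_fst, h_fst, Category.id_comp]
    · rw [Category.assoc, lift_snd, h_over, Category.id_comp]
  · rw [orbitMap, ModObj.comp_smul, lift_fst, lift_snd_assoc, hm]

end Split

variable {S : Type u} [CommRing S] [Algebra k S] {G : Grp (Sch k)} {T : Sch k} [ModObj G.X T]
  {p : T ⟶ specOver k S} {A B D : CommAlgCat.{u} S}

theorem specFunctor_map_comp (φ : A ⟶ B) (ψ : B ⟶ D) :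
    (specFunctor k S).map (φ ≫ ψ).op =
      (specFunctor k S).map ψ.op ≫ (specFunctor k S).map φ.op :=
  (specFunctor k S).map_comp ψ.op φ.op

theorem specFunctor_map_comp_eq {t : (specFunctor k S).obj (op A) ⟶ T} (ht : t ≫ p = specStr S A)
    (f g : A ⟶ B) :
    ((specFunctor k S).map f.op ≫ t) ≫ p = ((specFunctor k S).map g.op ≫ t) ≫ p := by
  rw [Category.assoc, Category.assoc, ht, specFunctor_map_specStr, specFunctor_map_specStr]

/-- The cocycle measuring the failure of a local section `t` of a torsor to descend: its value at
`f, g : A ⟶ B` is the point of `G` that moves `f(t)` to `g(t)`. -/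
def torsorCocycle (hp : IsPullback (snd G.X T) γ[G.X,T] p p)
    {t : (specFunctor k S).obj (op A) ⟶ T} (ht : t ≫ p = specStr S A) :
    Cocycle (pointsFunctor S G) A where
  val f g := transporter hp (specFunctor_map_comp_eq ht f g)
  naturality φ f g := by
    refine (comp_transporter hp ((specFunctor k S).map φ.op) _).trans ?_
    congr 1 <;> rw [specFunctor_map_comp, Category.assoc]
  val_mul_val f g h := transporter_mul_transporter hp _ _

theorem torsorCocycle_refine (hp : IsPullback (snd G.X T) γ[G.X,T] p p)
    {t : (specFunctor k S).obj (op A) ⟶ T} (ht : t ≫ p = specStr S A) (φ : A ⟶ B)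
    (htφ : ((specFunctor k S).map φ.op ≫ t) ≫ p = specStr S B) :
    (torsorCocycle hp ht).refine φ = torsorCocycle hp htφ := by
  ext D f g
  change transporter hp (specFunctor_map_comp_eq ht (φ ≫ f) (φ ≫ g)) =
    transporter hp (specFunctor_map_comp_eq htφ f g)
  congr 1 <;> rw [specFunctor_map_comp, Category.assoc]

theorem isSplitTorsor_of_isCoboundary (hA : faithfullyFlat S A)
    (hp : IsPullback (snd G.X T) γ[G.X,T] p p) {t : (specFunctor k S).obj (op A) ⟶ T}
    (ht : t ≫ p = specStr S A) (hc : (torsorCocycle hp ht).IsCoboundary) :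
    IsSplitTorsor G.X p := by
  obtain ⟨b, hb⟩ := hc
  change (specFunctor k S).obj (op A) ⟶ G.X at b
  obtain ⟨σ, hσ⟩ := exists_specStr_comp_eq hA (b⁻¹ • t) fun B f g => by
    have h_val : transporter hp (specFunctor_map_comp_eq ht f g) * ((specFunctor k S).map f.op ≫ b)
        = (specFunctor k S).map g.op ≫ b := hb f g
    have h_smul := transporter_smul hp (specFunctor_map_comp_eq ht f g)
    rw [ModObj.comp_smul, ModObj.comp_smul, GrpObj.comp_inv, GrpObj.comp_inv, ← h_smul, ← h_val,
      mul_inv_rev, mul_smul, inv_smul_smul]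
  refine isSplitTorsor_of_section hp (σ := σ) ?_
  have := epi_specStr (k := k) hA
  rw [← cancel_epi (specStr S A), reassoc_of% hσ, smul_comp_of_isPullback hp, ht,
    Category.comp_id]

/-- Every fppf `G`-torsor over `Spec S` is split. -/
def HasTrivialTorsorsOver (G : Grp (Sch k)) (S : Type u) [CommRing S] [Algebra k S] : Prop :=
  ∀ (T : Sch k) [ModObj G.X T] (p : T ⟶ specOver k S), IsFppfTorsor G.X p → IsSplitTorsor G.X p

theorem exists_specFunctor_section (hp : IsFppfTorsor G.X p) :
    ∃ (A : CommAlgCat.{u} S) (t : (specFunctor k S).obj (op A) ⟶ T),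
      faithfullyFlat S A ∧ t ≫ p = specStr S A := by
  obtain ⟨X', f, h, ⟨_, _, _⟩, h_pullback, _⟩ := hp.locallyTrivial
  have := quasiCompactCover_singleton_of_isOpenMap f.left f.left.isOpenMap
  obtain ⟨A, v, hA, hv⟩ := exists_faithfullyFlat_comp_eq f
  refine ⟨A, lift 1 v ≫ h, hA, ?_⟩
  rw [Category.assoc, h_pullback.w, lift_snd_assoc, hv]

theorem HasTrivialCocycles.hasTrivialTorsorsOver
    (h : HasTrivialCocycles (faithfullyFlat S) (pointsFunctor S G)) :
    HasTrivialTorsorsOver G S := by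
  intro T _ p hp
  obtain ⟨A, t, hA, ht⟩ := exists_specFunctor_section hp
  obtain ⟨B, φ, hB, hφ⟩ := h hA (torsorCocycle hp.isPullback ht)
  have htφ : ((specFunctor k S).map φ.op ≫ t) ≫ p = specStr S B := by
    rw [Category.assoc, ht, specFunctor_map_specStr]
  rw [torsorCocycle_refine hp.isPullback ht φ htφ] at hφ
  exact isSplitTorsor_of_isCoboundary hB hp.isPullback htφ hφ

end Torsor

/-! ### Split unipotent groups -/

section Unipotent

open scoped MonObj

variable {k : Type u} [Field k] {S : Type u} [CommRing S] [Algebra k S]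

theorem exists_comp_eq_specFunctor_map_comp {X Y : Sch k} (q : X ⟶ Y) [Flat q.left]
    [Surjective q.left] [QuasiCompact q.left] {A : CommAlgCat.{u} S} (hA : faithfullyFlat S A)
    (y : (specFunctor k S).obj (op A) ⟶ Y) :
    ∃ (B : CommAlgCat.{u} S) (φ : A ⟶ B), faithfullyFlat S B ∧
      ∃ x : (specFunctor k S).obj (op B) ⟶ X, x ≫ q = (specFunctor k S).map φ.op ≫ y := by
  let r := Limits.pullback.snd q y
  have h_pullback : IsPullback (Limits.pullback.fst q y).left r.left q.left y.left :=
    (IsPullback.of_hasPullback q y).map (Over.forget _)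
  have : QuasiCompact r.left := MorphismProperty.of_isPullback h_pullback inferInstance
  have : Flat r.left := MorphismProperty.of_isPullback h_pullback inferInstance
  have : Surjective r.left := MorphismProperty.of_isPullback h_pullback inferInstance
  obtain ⟨_, _⟩ := flat_and_surjective_specStr (k := k) hA
  have : Flat (r ≫ specStr S A).left := inferInstanceAs (Flat (r.left ≫ (specStr S A).left))
  have : Surjective (r ≫ specStr S A).left :=
    inferInstanceAs (Surjective (r.left ≫ (specStr S A).left))
  have : QuasiCompact (r ≫ specStr S A).left :=
    inferInstanceAs (QuasiCompact (r.left ≫ (specStr S A).left))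
  obtain ⟨B, v, hB, hv⟩ := exists_faithfullyFlat_comp_eq (r ≫ specStr S A)
  obtain ⟨φ, hφ⟩ := exists_specFunctor_map_eq (v ≫ r) ((Category.assoc _ _ _).trans hv)
  refine ⟨B, φ, hB, v ≫ Limits.pullback.fst q y, ?_⟩
  rw [hφ, Category.assoc, Category.assoc, Limits.pullback.condition]

namespace IsShortExact

variable {N U Q : Grp (Sch k)} {i : N ⟶ U} {q : U ⟶ Q}

theorem pointsMap_injective (h : IsShortExact i q) (A : CommAlgCat.{u} S) :
    Function.Injective ((pointsMap S i).app A) := fun _ _ hxy =>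
  h.isKernel.hom_ext (W := (specFunctor k S).obj (op A)) hxy (toUnit_unique _ _)

theorem exists_pointsMap_eq (h : IsShortExact i q) {A : CommAlgCat.{u} S}
    (x : (pointsFunctor S U).obj A) (hx : (pointsMap S q).app A x = 1) :
    ∃ y, (pointsMap S i).app A y = x :=
  ⟨h.isKernel.lift (W := (specFunctor k S).obj (op A)) x (toUnit _) hx, h.isKernel.lift_fst _ _ _⟩

theorem hasTrivialCocycles (h : IsShortExact i q) [QuasiCompact q.hom.hom.left]
    (hN : HasTrivialCocycles (faithfullyFlat S) (pointsFunctor S N))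
    (hQ : HasTrivialCocycles (faithfullyFlat S) (pointsFunctor S Q)) :
    HasTrivialCocycles (faithfullyFlat S) (pointsFunctor S U) := by
  have := h.flat
  have := h.surjective
  exact .of_exact h.pointsMap_injective (fun _ => h.exists_pointsMap_eq)
    (fun _ hA => exists_comp_eq_specFunctor_map_comp q.hom.hom hA) hN hQ

end IsShortExact

theorem quasiCompact_hom_left_of_affine {U Q : Grp (Sch k)} (q : U ⟶ Q) [IsAffine Q.X.left]
    [QuasiCompact U.X.hom] : QuasiCompact q.hom.hom.left := by
  have : QuasiCompact (q.hom.hom.left ≫ Q.X.hom) := by rwa [Over.w q.hom.hom]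
  exact QuasiCompact.of_comp _ Q.X.hom

theorem IsShortExact.quasiCompact {N U Q : Grp (Sch k)} {i : N ⟶ U} {q : U ⟶ Q}
    (h : IsShortExact i q) [IsAffine Q.X.left] [QuasiCompact U.X.hom] :
    QuasiCompact N.X.hom := by
  have : IsAffine (𝟙_ (Sch k)).left := inferInstanceAs (IsAffine (Spec _))
  have h_unit : QuasiCompact (η[Q.X]).left := inferInstance
  have : QuasiCompact i.hom.hom.left :=
    MorphismProperty.of_isPullback (h.isKernel.map (Over.forget _)).flip h_unit
  rw [← Over.w i.hom.hom]
  infer_instance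

theorem hasTrivialCocycles_of_isIso_toUnit {U : Grp (Sch k)} [IsIso (toUnit U.X)] :
    HasTrivialCocycles (faithfullyFlat S) (pointsFunctor S U) :=
  hasTrivialCocycles_of_isCoboundary fun _ _ _ => ⟨1, fun A _ _ =>
    (cancel_mono (Z := (specFunctor k S).obj (op A)) (toUnit U.X)).1 (toUnit_unique _ _)⟩

theorem HasGaTower.hasTrivialCocycles {U : Grp (Sch k)} (h : HasGaTower U)
    (hU : QuasiCompact U.X.hom) :
    HasTrivialCocycles (faithfullyFlat S) (pointsFunctor S U) := by
  induction h with
  | trivial U _ => exact hasTrivialCocycles_of_isIso_toUnit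
  | step N U i q h _ ih =>
    have : IsAffine (Ga k).X.left := inferInstanceAs (IsAffine (Spec _))
    have := quasiCompact_hom_left_of_affine q
    exact h.hasTrivialCocycles (ih h.quasiCompact)
      ((hasTrivialCocycles_ga S).of_iso (pointsAffineGroupIso S _ _ (gaCorepresentableBy k)).symm)

end Unipotent

section TrivialTorsors

variable {k : Type u} [Field k] {S : Type u} [CommRing S] [Algebra k S]

theorem FreeOfConstantRank.hasTrivialTorsorsOver_gl (hS : FreeOfConstantRank S) (n : ℕ) :
    HasTrivialTorsorsOver (GLn k n) S :=
  (hS.hasTrivialCocycles_gl.of_iso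
    (pointsAffineGroupIso S _ _ (glCorepresentableBy k n)).symm).hasTrivialTorsorsOver

theorem FreeOfConstantRank.hasTrivialTorsorsOver_sl (hS : FreeOfConstantRank S) (n : ℕ) :
    HasTrivialTorsorsOver (SLn k n) S :=
  (hS.hasTrivialCocycles_sl.of_iso
    (pointsAffineGroupIso S _ _ (slCorepresentableBy k n)).symm).hasTrivialTorsorsOver

theorem FreeOfConstantRank.hasTrivialTorsorsOver_sp (hS : FreeOfConstantRank S) (n : ℕ) :
    HasTrivialTorsorsOver (Sp2n k n) S :=
  ((hS.hasTrivialCocycles_sp n).of_iso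
    (pointsAffineGroupIso S _ _ (spCorepresentableBy k n)).symm).hasTrivialTorsorsOver

theorem HasGaTower.hasTrivialTorsorsOver {U : Grp (Sch k)} (h : HasGaTower U)
    (hU : QuasiCompact U.X.hom) : HasTrivialTorsorsOver U S :=
  (h.hasTrivialCocycles hU).hasTrivialTorsorsOver

end TrivialTorsors

end SpecialGroups

end

theorem lemma3p2_general (k : Type u) [Field k] (S : Type u) [CommRing S] [Algebra k S] :
    (SpecialGroups.FreeOfConstantRank S → ∀ n : ℕ,
      SpecialGroups.HasTrivialTorsorsOver (SpecialGroups.GLn k n) S ∧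
      SpecialGroups.HasTrivialTorsorsOver (SpecialGroups.SLn k n) S ∧
      SpecialGroups.HasTrivialTorsorsOver (SpecialGroups.Sp2n k n) S) ∧
    (∀ U : Grp (SpecialGroups.Sch k), SpecialGroups.HasGaTower U → QuasiCompact U.X.hom →
      SpecialGroups.HasTrivialTorsorsOver U S) :=
  ⟨fun hS n => ⟨hS.hasTrivialTorsorsOver_gl n, hS.hasTrivialTorsorsOver_sl n,
    hS.hasTrivialTorsorsOver_sp n⟩, fun _ hU h => hU.hasTrivialTorsorsOver h⟩

theorem lemma3p2 (k : Type u) [Field k] :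
    (∀ n : ℕ, 0 < n → SpecialGroups.HasTrivialTorsorsOverSemilocal (SpecialGroups.GLn k n)) ∧
    (∀ n : ℕ, 0 < n → SpecialGroups.HasTrivialTorsorsOverSemilocal (SpecialGroups.SLn k n)) ∧
    (∀ n : ℕ, 0 < n → SpecialGroups.HasTrivialTorsorsOverSemilocal (SpecialGroups.Sp2n k n)) ∧
    (∀ U : Grp (SpecialGroups.Sch k), SpecialGroups.IsSplitUnipotent U →
      SpecialGroups.HasTrivialTorsorsOverSemilocal U) :=
  have h_matrix (S : Type u) [CommRing S] [Algebra k S] [Finite (MaximalSpectrum S)] :=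
    (lemma3p2_general k S).1 (SpecialGroups.freeOfConstantRank_of_finite_maximalSpectrum S)
  ⟨fun n _ S => (h_matrix S n).1, fun n _ S => (h_matrix S n).2.1,
    fun n _ S => (h_matrix S n).2.2,
    fun U hU S => (lemma3p2_general k S).2 U hU.tower hU.quasiCompact⟩
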